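/- Let $1<p<\infty$. There is a constant $C=C(p)>0$, depending only on $p$, such that the following holds. Let $N\ge 1$ be an integer and $0<s<1$ with $sp<N$, let $\Omega\subset\mathbb R^N$ be open and bounded, let $N/(sp)<q\le\infty$ and $F\in L^q(\Omega)$. Write $$[u]^p=\int_{\mathbb R^N}\int_{\mathbb R^N}\frac{|u(x)-u(y)|^p}{|x-y|^{N+sp}}\,dx\,dy ,$$ and let $\widetilde W^{s,p}_0(\Omega)$ be the completion of $C^\infty_0(\Omega)$ with respect to the norm $[\,\cdot\,]$, viewed as a space of functions on $\mathbb R^N$ that vanish a.e. outside $\Omega$. Put $$p^*=\frac{Np}{N-sp},\qquad q'=\Big(1-\frac1q\Big)^{-1},\qquad \chi=\frac{p^*}{p\,q'},$$ $$T_{p,s}=\sup\Big\{\Big(\int_{\mathbb R^N}|v|^{p^*}dx\Big)^{p/p^*}\;:\; v\in W^{s,p}_0(\mathbb R^N),\ [v]^p=1\Big\},$$ where $W^{s,p}_0(\mathbb R^N)$ is the completion of $C^\infty_0(\mathbb R^N)$ with respect to $\|\cdot\|_{L^p(\mathbb R^N)}+[\,\cdot\,]$ (and $1/q=0$, $q'=1$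 if $q=\infty$). Let $u\in\widetilde W^{s,p}_0(\Omega)$ be a weak solution of $(-\Delta_p)^su=F$ in $\Omega$, $u=0$ in $\mathbb R^N\setminus\Omega$, that is, $$\int_{\mathbb R^N}\int_{\mathbb R^N}\frac{|u(x)-u(y)|^{p-2}(u(x)-u(y))}{|x-y|^{N+sp}}\,(\varphi(x)-\varphi(y))\,dx\,dy=\int_\Omega F\varphi\,dx\qquad\text{for every }\varphi\in\widetilde W^{s,p}_0(\Omega).$$ Then $u\in L^\infty(\Omega)$, the constant $T_{p,s}$ is finite, and $$\|u\|_{L^\infty(\Omega)}\le\Big(C\,\chi^{\frac1{\chi-1}}\Big)^{\frac{\chi}{\chi-1}}\Big(T_{p,s}\,|\Omega|^{\frac{sp}{N}-\frac1q}\,\|F\|_{L^q(\Omega)}\Big)^{\frac1{p-1}} .$$ -/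

import Mathlib

open MeasureTheory Filter Topology
open scoped ENNReal ContDiff

noncomputable section

namespace FracPLap

/-- The space `C^∞_0(Ω)` of smooth functions with compact support contained in `Ω ⊆ ℝ^N`. -/
def testFun {N : ℕ} (Ω : Set (EuclideanSpace ℝ (Fin N))) :
    Set (EuclideanSpace ℝ (Fin N) → ℝ) :=
  {φ | ContDiff ℝ ∞ φ ∧ HasCompactSupport φ ∧ tsupport φ ⊆ Ω}

/-- The Gagliardo energy `∬ |u(x) - u(y)|^p / |x - y|^(N + s p) dx dy` over `ℝ^N × ℝ^N`,
i.e. the `p`-th power of the Gagliardo seminorm, with values in `[0, ∞]`. -/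
def gagliardo {N : ℕ} (s p : ℝ) (u : EuclideanSpace ℝ (Fin N) → ℝ) : ℝ≥0∞ :=
  ∫⁻ z : EuclideanSpace ℝ (Fin N) × EuclideanSpace ℝ (Fin N),
    ‖u z.1 - u z.2‖ₑ ^ p / ‖z.1 - z.2‖ₑ ^ ((N : ℝ) + s * p)

/-- For `Ω` bounded and open: the completion of `C^∞_0(Ω)` with respect to the Gagliardo
seminorm, realized as a space of functions on `ℝ^N` vanishing a.e. outside `Ω`. (For bounded `Ω`
the seminorm controls the `L^p` norm of functions vanishing outside `Ω`, hence each element of the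
abstract completion is exactly one such function up to a.e. equality.) -/
def tildeW0 {N : ℕ} (s p : ℝ) (Ω : Set (EuclideanSpace ℝ (Fin N))) :
    Set (EuclideanSpace ℝ (Fin N) → ℝ) :=
  {u | AEStronglyMeasurable u volume ∧ (∀ᵐ x, x ∉ Ω → u x = 0) ∧
    ∃ φ : ℕ → EuclideanSpace ℝ (Fin N) → ℝ, (∀ n, φ n ∈ testFun Ω) ∧
      Tendsto (fun n => gagliardo s p (u - φ n)) atTop (𝓝 0)}

/-- `W^{s,p}_0(ℝ^N)`: the completion of `C^∞_0(ℝ^N)` with respect to the full norm, the sum of the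
`L^p(ℝ^N)` norm and the Gagliardo seminorm. -/
def W0 (N : ℕ) (s p : ℝ) : Set (EuclideanSpace ℝ (Fin N) → ℝ) :=
  {v | AEStronglyMeasurable v volume ∧
    ∃ φ : ℕ → EuclideanSpace ℝ (Fin N) → ℝ, (∀ n, φ n ∈ testFun Set.univ) ∧
      Tendsto (fun n => eLpNorm (v - φ n) (ENNReal.ofReal p) volume) atTop (𝓝 0) ∧
      Tendsto (fun n => gagliardo s p (v - φ n)) atTop (𝓝 0)}

/-- The critical Sobolev exponent `p^* = N p / (N - s p)`. -/
def pStar (N : ℕ) (s p : ℝ) : ℝ := N * p / (N - s * p)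

/-- The sharp Sobolev constant `T_{p,s}`: the supremum of `(∫ |v|^{p^*})^{p / p^*}` over all
`v ∈ W^{s,p}_0(ℝ^N)` with Gagliardo energy `1`. -/
def sobolevConst (N : ℕ) (s p : ℝ) : ℝ≥0∞ :=
  ⨆ v ∈ {v | v ∈ W0 N s p ∧ gagliardo s p v = 1},
    (∫⁻ x : EuclideanSpace ℝ (Fin N), ‖v x‖ₑ ^ pStar N s p) ^ (p / pStar N s p)

/-- `u` is a weak solution in `W̃^{s,p}_0(Ω)` of `(-Δ_p)^s u = F` in `Ω`, `u = 0` outside `Ω`. -/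
def IsWeakSolution {N : ℕ} (s p : ℝ) (Ω : Set (EuclideanSpace ℝ (Fin N)))
    (F u : EuclideanSpace ℝ (Fin N) → ℝ) : Prop :=
  u ∈ tildeW0 s p Ω ∧ ∀ φ ∈ tildeW0 s p Ω,
    ∫ z : EuclideanSpace ℝ (Fin N) × EuclideanSpace ℝ (Fin N),
      |u z.1 - u z.2| ^ (p - 2) * (u z.1 - u z.2) / ‖z.1 - z.2‖ ^ ((N : ℝ) + s * p) *
        (φ z.1 - φ z.2)
      = ∫ x in Ω, F x * φ x

/-- The conjugate exponent `q' = (1 - 1/q)⁻¹` of `1 < q ≤ ∞` (with `1/∞ = 0`, so `∞' = 1`). -/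
def conjExp (q : ℝ≥0∞) : ℝ := (1 - 1 / q.toReal)⁻¹

/-- `χ = p^* / (p q')`. -/
def chi (N : ℕ) (s p : ℝ) (q : ℝ≥0∞) : ℝ := pStar N s p / (p * conjExp q)

end FracPLap

end

/-! The bound comes from Stampacchia truncation. Let w_k = sign(u)(|u| - k)₊ and A_k = {|u| > k} in
Ω. Since t ↦ sign(t)(|t| - k)₊ is nondecreasing and 1-Lipschitz, testing the equation with w_k gives
[w_k]^p ≤ ∫ |F||w_k| (`gagliardo_softThreshold_le`). The Sobolev inequality on the left and Hölder
on A_k on the right leave ‖w_k‖_{p*}^{p-1} ≤ T ‖F‖_q |A_k|^{1 - 1/q - 1/p*}, and |w_k| ≥ h - k on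
A_h. Hence b(k) = |A_k|^{1/p*} satisfies (h - k) b(h) ≤ K b(k)^β with K = (T‖F‖_q)^{1/(p-1)} and β =
(pχ - 1)/(p - 1) (`superlevel_decay`). The condition q > N/(sp) says exactly that χ > 1,
equivalently β > 1, so `stampacchia` makes b vanish at a finite height. That height is at most the
claimed bound with C = 2.

Two facts must be supplied. Finiteness of T: |u(x)|^p is compared with its average over a ball about
x, the radius is optimized pointwise, and the result is integrated and absorbed. This works for
functions already in L^{p*}, such as test functions; Fatou carries it to the completion.
Admissibility of w_k: truncation is not smooth, so it is approximated by smooth maps, which preserve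
test functions, and the space is closed under Gagliardo convergence. -/

namespace FracPLap

/-! ### Gagliardo energy: quasi-triangle inequality and convergence -/

section Basics

variable {N : ℕ} {s p : ℝ} {u v : EuclideanSpace ℝ (Fin N) → ℝ}

lemma aestronglyMeasurable_diff (hu : AEStronglyMeasurable u volume) :
    AEStronglyMeasurable
      (fun z : EuclideanSpace ℝ (Fin N) × EuclideanSpace ℝ (Fin N) => u z.1 - u z.2) volume :=
  (hu.comp_quasiMeasurePreserving Measure.quasiMeasurePreserving_fst).sub
    (hu.comp_quasiMeasurePreserving Measure.quasiMeasurePreserving_snd)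

lemma measurable_kernel (a : ℝ) : Measurable
    (fun z : EuclideanSpace ℝ (Fin N) × EuclideanSpace ℝ (Fin N) => ‖z.1 - z.2‖ₑ ^ a) := by
  fun_prop

lemma aemeasurable_gagliardo_integrand (hu : AEStronglyMeasurable u volume) (a : ℝ) :
    AEMeasurable (fun z : EuclideanSpace ℝ (Fin N) × EuclideanSpace ℝ (Fin N) =>
      ‖u z.1 - u z.2‖ₑ ^ p / ‖z.1 - z.2‖ₑ ^ a) volume :=
  ((aestronglyMeasurable_diff hu).enorm.pow_const p).div (measurable_kernel a).aemeasurable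

lemma gagliardo_neg : gagliardo s p (-u) = gagliardo s p u := by
  unfold gagliardo
  congr 1 with z
  rw [Pi.neg_apply, Pi.neg_apply, ← enorm_neg]
  congr 3
  ring

lemma gagliardo_const_smul (hp : 0 ≤ p) (c : ℝ) :
    gagliardo s p (c • u) = ‖c‖ₑ ^ p * gagliardo s p u := by
  unfold gagliardo
  rw [← lintegral_const_mul' _ _ (ENNReal.rpow_ne_top_of_nonneg hp enorm_ne_top)]
  congr 1 with z
  rw [Pi.smul_apply, Pi.smul_apply, ← smul_sub, enorm_smul, ENNReal.mul_rpow_of_nonneg _ _ hp,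
    mul_div_assoc]

lemma gagliardo_add_le (hp : 1 ≤ p) (hu : AEStronglyMeasurable u volume) :
    gagliardo s p (u + v) ≤ 2 ^ (p - 1) * (gagliardo s p u + gagliardo s p v) := by
  unfold gagliardo
  rw [← lintegral_add_left' (aemeasurable_gagliardo_integrand hu _),
    ← lintegral_const_mul' _ _ (by finiteness)]
  refine lintegral_mono fun z => ?_
  rw [← ENNReal.add_div, ← mul_div_assoc]
  gcongr
  refine le_trans ?_ (ENNReal.rpow_add_le_mul_rpow_add_rpow _ _ hp)
  gcongr
  refine le_trans (le_of_eq ?_) (enorm_add_le _ _)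
  congr 1
  simp only [Pi.add_apply]; ring

lemma gagliardo_sub_le (hp : 1 ≤ p) (hu : AEStronglyMeasurable u volume) :
    gagliardo s p (u - v) ≤ 2 ^ (p - 1) * (gagliardo s p u + gagliardo s p v) := by
  rw [sub_eq_add_neg, ← gagliardo_neg (u := v)]
  exact gagliardo_add_le hp hu

/-- A generalized dominated convergence. The increments of v - w_n are at most 2c|Du| + c|D(u -
φ_n)|, where D denotes the increment. Cut off at 2c|Du|, they have a fixed integrable majorant and
tend to 0 a.e.; the excess is controlled by the energy of u - φ_n. This is what makes composition
with Lipschitz maps continuous along approximating sequences. -/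
lemma tendsto_gagliardo_sub (hp : 1 ≤ p) {c : ℝ} (hc : 0 ≤ c)
    {φ w : ℕ → EuclideanSpace ℝ (Fin N) → ℝ}
    (hu : AEStronglyMeasurable u volume) (hv : AEStronglyMeasurable v volume)
    (hw : ∀ n, AEStronglyMeasurable (w n) volume)
    (hfin : gagliardo s p u ≠ ⊤)
    (hlim : Tendsto (fun n => gagliardo s p (u - φ n)) atTop (𝓝 0))
    (hvu : ∀ x y, |v x - v y| ≤ c * |u x - u y|)
    (hwφ : ∀ n x y, |w n x - w n y| ≤ c * |φ n x - φ n y|)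
    (hae : ∀ᵐ x, Tendsto (fun n => w n x) atTop (𝓝 (v x))) :
    Tendsto (fun n => gagliardo s p (v - w n)) atTop (𝓝 0) := by
  have hp0 : 0 < p := by linarith
  set k : EuclideanSpace ℝ (Fin N) × EuclideanSpace ℝ (Fin N) → ℝ≥0∞ :=
    fun z => ‖z.1 - z.2‖ₑ ^ ((N : ℝ) + s * p) with hk
  set W : ℕ → EuclideanSpace ℝ (Fin N) × EuclideanSpace ℝ (Fin N) → ℝ :=
    fun n z => (v - w n) z.1 - (v - w n) z.2 with hW
  set g : ℕ → EuclideanSpace ℝ (Fin N) × EuclideanSpace ℝ (Fin N) → ℝ≥0∞ :=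
    fun n z => min ‖W n z‖ₑ (ENNReal.ofReal (2 * c) * ‖u z.1 - u z.2‖ₑ) ^ p / k z with hg
  have hWm : ∀ n, AEStronglyMeasurable (W n) volume := fun n =>
    aestronglyMeasurable_diff (hv.sub (hw n))
  have hgm : ∀ n, AEMeasurable (g n) volume := fun n =>
    (((hWm n).enorm.min ((aestronglyMeasurable_diff hu).enorm.const_mul _)).pow_const p).div
      (measurable_kernel _).aemeasurable
  have hg0 : Tendsto (fun n => ∫⁻ z, g n z) atTop (𝓝 0) := by
    have hb : ∀ n, ∀ᵐ z, g n z ≤ ENNReal.ofReal (2 * c) ^ p *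
        (‖u z.1 - u z.2‖ₑ ^ p / k z) := fun n => Eventually.of_forall fun z => by
      rw [hg, ← mul_div_assoc, ← ENNReal.mul_rpow_of_nonneg _ _ hp0.le]
      dsimp only
      gcongr
      exact min_le_right _ _
    have := tendsto_lintegral_of_dominated_convergence' (f := fun _ => (0 : ℝ≥0∞))
      (fun z => ENNReal.ofReal (2 * c) ^ p * (‖u z.1 - u z.2‖ₑ ^ p / k z)) hgm hb ?_ ?_
    · simpa using this
    · rw [lintegral_const_mul' _ _ (by finiteness)]
      exact ENNReal.mul_ne_top (by finiteness) hfin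
    · filter_upwards [Measure.quasiMeasurePreserving_fst.ae hae,
        Measure.quasiMeasurePreserving_snd.ae hae] with z h1 h2
      -- On the diagonal the quotient reads 0 / 0, which is 0 in `ℝ≥0∞`.
      by_cases hz : z.1 = z.2
      · have : ∀ n, g n z = 0 := fun n => by
          simp [hg, hW, hz, hp0]
        simp [this]
      · have hW0 : Tendsto (fun n => W n z) atTop (𝓝 0) := by
          have := (tendsto_const_nhds (x := v z.1)).sub h1 |>.sub
            ((tendsto_const_nhds (x := v z.2)).sub h2)
          simpa [hW] using this
        have h3 : Tendsto (fun n => ‖W n z‖ₑ) atTop (𝓝 0) := by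
          simpa using hW0.enorm
        have h4 : Tendsto (fun n => ‖W n z‖ₑ ^ p / k z) atTop (𝓝 0) := by
          have hkz : k z ≠ 0 := by
            simp only [hk]
            have : ‖z.1 - z.2‖ₑ ≠ 0 := by simpa [sub_eq_zero] using hz
            exact (ENNReal.rpow_pos (pos_iff_ne_zero.2 this) (by simp)).ne'
          have := ENNReal.Tendsto.div_const (b := k z)
            ((ENNReal.continuous_rpow_const (y := p)).tendsto 0 |>.comp h3) (Or.inr hkz)
          simpa [hp0, Function.comp_def] using this
        refine tendsto_of_tendsto_of_tendsto_of_le_of_le tendsto_const_nhds h4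
          (fun _ => zero_le) fun n => ?_
        simp only [hg]
        gcongr
        exact min_le_left _ _
  have hmain : ∀ n, gagliardo s p (v - w n) ≤
      2 ^ (p - 1) * (ENNReal.ofReal c ^ p * gagliardo s p (u - φ n) + ∫⁻ z, g n z) := by
    intro n
    unfold gagliardo
    rw [← lintegral_const_mul' _ _ (by finiteness), ← lintegral_add_right' _ (hgm n),
      ← lintegral_const_mul' _ _ (by finiteness)]
    refine lintegral_mono fun z => ?_
    simp only [hg]
    rw [← mul_div_assoc, ← ENNReal.mul_rpow_of_nonneg _ _ hp0.le, ← ENNReal.add_div,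
      ← mul_div_assoc]
    refine ENNReal.div_le_div_right ?_ _
    refine le_trans ?_ (ENNReal.rpow_add_le_mul_rpow_add_rpow _ _ hp)
    gcongr
    rcases le_total ‖W n z‖ₑ (ENNReal.ofReal (2 * c) * ‖u z.1 - u z.2‖ₑ) with h | h
    · rw [min_eq_left h]; exact le_add_self
    · rw [min_eq_right h]
      simp only [Real.enorm_eq_ofReal_abs]
      rw [← ENNReal.ofReal_mul hc, ← ENNReal.ofReal_mul (by positivity),
        ← ENNReal.ofReal_add (by positivity) (by positivity)]
      refine ENNReal.ofReal_le_ofReal ?_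
      simp only [Pi.sub_apply]
      have e1 : |v z.1 - w n z.1 - (v z.2 - w n z.2)| ≤ |v z.1 - v z.2| + |w n z.1 - w n z.2| := by
        rw [show v z.1 - w n z.1 - (v z.2 - w n z.2) = (v z.1 - v z.2) - (w n z.1 - w n z.2) by
          ring]
        exact abs_sub _ _
      have e2 : |φ n z.1 - φ n z.2| ≤
          |u z.1 - φ n z.1 - (u z.2 - φ n z.2)| + |u z.1 - u z.2| := by
        rw [show φ n z.1 - φ n z.2 = (u z.1 - u z.2) - (u z.1 - φ n z.1 - (u z.2 - φ n z.2)) by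
          ring, add_comm]
        exact abs_sub _ _
      nlinarith [hvu z.1 z.2, hwφ n z.1 z.2, mul_le_mul_of_nonneg_left e2 hc]
  refine tendsto_of_tendsto_of_tendsto_of_le_of_le tendsto_const_nhds ?_ (fun _ => zero_le) hmain
  have h1 : Tendsto (fun n => ENNReal.ofReal c ^ p * gagliardo s p (u - φ n)) atTop (𝓝 0) := by
    simpa using ENNReal.Tendsto.const_mul (a := ENNReal.ofReal c ^ p) hlim
      (Or.inr (by finiteness))
  simpa using ENNReal.Tendsto.const_mul (a := (2 : ℝ≥0∞) ^ (p - 1)) (h1.add hg0)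
      (Or.inr (by finiteness))

end Basics

/-! ### Fractional Sobolev inequality and finiteness of the sharp constant -/

section Sobolev

/-- Optimization over the scale `t` in a two-term bound. -/
lemma le_of_forall_scale {θ : ℝ} (hθ1 : θ < 1) {a B D c : ℝ≥0∞} (hc : c ≠ ⊤)
    (hB0 : B ≠ 0) (hB : B ≠ ⊤)
    (h : ∀ t : ℝ, 0 < t →
      a ≤ c * (ENNReal.ofReal t ^ θ * D + ENNReal.ofReal t ^ (θ - 1) * B)) :
    a ≤ 2 * c * (B ^ θ * D ^ (1 - θ)) := by
  have hB' : B ^ θ ≠ 0 := by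
    simp [ENNReal.rpow_eq_zero_iff, hB0, hB]
  rcases eq_or_ne c 0 with rfl | hc0
  · simpa using h 1 one_pos
  rcases eq_or_ne D ⊤ with rfl | hD
  · rw [ENNReal.top_rpow_of_pos (by linarith), ENNReal.mul_top hB', ENNReal.mul_top (by simp [hc0])]
    exact le_top
  rcases eq_or_ne D 0 with rfl | hD0
  -- With D = 0 there is no optimal scale; the other term vanishes as t → ∞ because θ < 1.
  · have h1 : Tendsto (fun t : ℝ => c * (ENNReal.ofReal (t ^ (θ - 1)) * B)) atTop (𝓝 0) := by
      have h2 : Tendsto (fun t : ℝ => t ^ (θ - 1)) atTop (𝓝 0) := by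
        simpa using tendsto_rpow_neg_atTop (y := 1 - θ) (by linarith)
      have h3 := ENNReal.Tendsto.mul_const (b := B) (ENNReal.tendsto_ofReal h2) (Or.inr hB)
      simpa using ENNReal.Tendsto.const_mul (a := c) h3 (Or.inr hc)
    have h4 : a ≤ 0 := ge_of_tendsto h1 (by
      filter_upwards [eventually_gt_atTop 0] with t ht
      have := h t ht
      rwa [mul_zero, zero_add, ENNReal.ofReal_rpow_of_pos ht] at this)
    exact h4.trans zero_le
  · obtain ⟨b, hb, rfl⟩ : ∃ b : ℝ, 0 < b ∧ B = ENNReal.ofReal b :=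
      ⟨B.toReal, ENNReal.toReal_pos hB0 hB, (ENNReal.ofReal_toReal hB).symm⟩
    obtain ⟨d, hd, rfl⟩ : ∃ d : ℝ, 0 < d ∧ D = ENNReal.ofReal d :=
      ⟨D.toReal, ENNReal.toReal_pos hD0 hD, (ENNReal.ofReal_toReal hD).symm⟩
    -- The scale t = b/d makes the two terms equal, whence the factor 2.
    refine (h (b / d) (by positivity)).trans (le_of_eq ?_)
    rw [mul_comm 2 c, mul_assoc, two_mul]
    have hbd : 0 < b / d := by positivity
    rw [ENNReal.ofReal_rpow_of_pos hbd, ENNReal.ofReal_rpow_of_pos hbd,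
      ENNReal.ofReal_rpow_of_pos hb, ENNReal.ofReal_rpow_of_pos hd,
      ← ENNReal.ofReal_mul (by positivity), ← ENNReal.ofReal_mul (by positivity),
      ← ENNReal.ofReal_mul (by positivity)]
    have e1 : (b / d) ^ θ * d = b ^ θ * d ^ (1 - θ) := by
      rw [Real.div_rpow hb.le hd.le, Real.rpow_sub hd, Real.rpow_one]
      ring
    have e2 : (b / d) ^ (θ - 1) * b = b ^ θ * d ^ (1 - θ) := by
      rw [Real.rpow_sub hbd, Real.div_rpow hb.le hd.le, Real.rpow_sub hd, Real.rpow_one,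
        Real.rpow_one]
      field_simp
    rw [e1, e2]

lemma lintegral_rpow_le_rpow_mul_measure {α : Type*} [MeasurableSpace α] {μ : Measure α}
    {f : α → ℝ} (hf : AEStronglyMeasurable f μ) {a b : ℝ} (ha : 0 < a) (hab : a ≤ b) :
    ∫⁻ x, ‖f x‖ₑ ^ a ∂μ ≤ (∫⁻ x, ‖f x‖ₑ ^ b ∂μ) ^ (a / b) * μ Set.univ ^ (1 - a / b) := by
  have h := eLpNorm'_le_eLpNorm'_mul_rpow_measure_univ ha hab hf
  unfold eLpNorm' at h
  have h2 := ENNReal.rpow_le_rpow h ha.le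
  rw [← ENNReal.rpow_mul, ENNReal.mul_rpow_of_nonneg _ _ ha.le, ← ENNReal.rpow_mul,
    ← ENNReal.rpow_mul, one_div_mul_cancel ha.ne', ENNReal.rpow_one] at h2
  convert h2 using 3
  · ring
  · field_simp

variable {N : ℕ} {s p : ℝ}

lemma div_pStar (hN : 0 < (N : ℝ)) (hp : 0 < p) (hsp : s * p < N) :
    p / pStar N s p = 1 - s * p / N := by
  have : (N : ℝ) - s * p ≠ 0 := by linarith
  unfold pStar
  field_simp

lemma pStar_pos (hN : 0 < (N : ℝ)) (hp : 0 < p) (hsp : s * p < N) : 0 < pStar N s p := by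
  have : 0 < (N : ℝ) - s * p := by linarith
  unfold pStar
  positivity

lemma le_pStar (hN : 0 < (N : ℝ)) (hp : 0 < p) (hs : 0 < s) (hsp : s * p < N) :
    p ≤ pStar N s p := by
  have h := div_pStar hN hp hsp
  have h0 := pStar_pos hN hp hsp
  have : 0 < s * p / N := by positivity
  exact (div_le_one h0).1 (by linarith)

/-- The finite constant in the fractional Sobolev inequality. -/
noncomputable def sobolevBound (N : ℕ) (s p : ℝ) : ℝ≥0∞ :=
  (2 * (2 ^ (p - 1) * ((volume (Metric.ball (0 : EuclideanSpace ℝ (Fin N)) 1))⁻¹ +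
    volume (Metric.ball (0 : EuclideanSpace ℝ (Fin N)) 1) ^ (s * p / N - 1)))) ^
      (1 / (1 - s * p / N))

lemma volume_unitBall_pos : 0 < volume (Metric.ball (0 : EuclideanSpace ℝ (Fin N)) 1) :=
  Metric.measure_ball_pos _ _ one_pos

lemma sobolevBound_base_ne_top (N : ℕ) (s p : ℝ) :
    2 ^ (p - 1) * ((volume (Metric.ball (0 : EuclideanSpace ℝ (Fin N)) 1))⁻¹ +
    volume (Metric.ball (0 : EuclideanSpace ℝ (Fin N)) 1) ^ (s * p / N - 1)) ≠ ⊤ := by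
  have h0 := (volume_unitBall_pos (N := N)).ne'
  have h1 : volume (Metric.ball (0 : EuclideanSpace ℝ (Fin N)) 1) ≠ ⊤ := measure_ball_lt_top.ne
  refine ENNReal.mul_ne_top (by finiteness) (ENNReal.add_ne_top.2 ⟨by simpa using h0, ?_⟩)
  exact ENNReal.rpow_ne_top_of_ne_zero h0 h1

lemma sobolevBound_ne_top (hN : 0 < (N : ℝ)) (hsp : s * p < N) : sobolevBound N s p ≠ ⊤ := by
  have : s * p / N < 1 := (div_lt_one hN).2 hsp
  refine ENNReal.rpow_ne_top_of_nonneg ?_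
    (ENNReal.mul_ne_top (by simp) (sobolevBound_base_ne_top N s p))
  exact one_div_nonneg.2 (by linarith)

/-- Average |u(x)|^p ≤ 2^{p-1}(|u(x) - u(y)|^p + |u(y)|^p) over y in a ball about x of measure tν,
where ν is the volume of the unit ball. In the first term |x - y|^{N+sp} ≤ t^{1+θ} with θ = sp/N;
the second is bounded by Hölder with exponent p*/p. -/
lemma enorm_rpow_le_scale (hN : 0 < (N : ℝ)) (hp : 1 < p) (hs : 0 < s) (hsp : s * p < N)
    {u : EuclideanSpace ℝ (Fin N) → ℝ} (hu : AEStronglyMeasurable u volume)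
    (x : EuclideanSpace ℝ (Fin N)) {t : ℝ} (ht : 0 < t) :
    ‖u x‖ₑ ^ p ≤ 2 ^ (p - 1) * ((volume (Metric.ball (0 : EuclideanSpace ℝ (Fin N)) 1))⁻¹ +
        volume (Metric.ball (0 : EuclideanSpace ℝ (Fin N)) 1) ^ (s * p / N - 1)) *
      (ENNReal.ofReal t ^ (s * p / N) *
          (∫⁻ y, ‖u x - u y‖ₑ ^ p / ‖x - y‖ₑ ^ ((N : ℝ) + s * p)) +
        ENNReal.ofReal t ^ (s * p / N - 1) *
          (∫⁻ y, ‖u y‖ₑ ^ pStar N s p) ^ (p / pStar N s p)) := by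
  have hp0 : 0 < p := by linarith
  set ν := volume (Metric.ball (0 : EuclideanSpace ℝ (Fin N)) 1) with hν
  have hν0 : ν ≠ 0 := (volume_unitBall_pos (N := N)).ne'
  have hνt : ν ≠ ⊤ := measure_ball_lt_top.ne
  set θ := s * p / N with hθ
  set r : ℝ := t ^ (1 / (N : ℝ)) with hr
  have hr0 : 0 < r := by positivity
  have hrN : r ^ N = t := by
    rw [hr, ← Real.rpow_natCast, ← Real.rpow_mul ht.le, one_div_mul_cancel hN.ne', Real.rpow_one]
  set T := ENNReal.ofReal t with hT
  have hT0 : T ≠ 0 := by simpa [hT] using ht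
  have hTt : T ≠ ⊤ := ENNReal.ofReal_ne_top
  have hV : volume (Metric.ball x r) = T * ν := by
    rw [Measure.addHaar_ball_of_pos _ _ hr0, finrank_euclideanSpace_fin, hrN]
  set D := ∫⁻ y, ‖u x - u y‖ₑ ^ p / ‖x - y‖ₑ ^ ((N : ℝ) + s * p) with hD
  set B := (∫⁻ y, ‖u y‖ₑ ^ pStar N s p) ^ (p / pStar N s p) with hB
  have h1 : ∫⁻ y in Metric.ball x r, ‖u x - u y‖ₑ ^ p ≤ T ^ (1 + θ) * D := by
    have hTr : T ^ (1 + θ) = ENNReal.ofReal r ^ ((N : ℝ) + s * p) := by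
      rw [hT, ENNReal.ofReal_rpow_of_pos ht, ENNReal.ofReal_rpow_of_pos hr0, hr,
        ← Real.rpow_mul ht.le]
      congr 2
      rw [hθ]; field_simp
    rw [hD, ← lintegral_const_mul' _ _ (by finiteness)]
    refine (setLIntegral_mono_ae' measurableSet_ball (ae_of_all _ fun y hy => ?_)).trans
      (setLIntegral_le_lintegral _ _)
    rcases eq_or_ne x y with rfl | hxy
    · simp [hp0]
    have hk0 : ‖x - y‖ₑ ^ ((N : ℝ) + s * p) ≠ 0 :=
      (ENNReal.rpow_pos (by simpa [sub_eq_zero] using hxy) (by simp)).ne'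
    have hkt : ‖x - y‖ₑ ^ ((N : ℝ) + s * p) ≠ ⊤ :=
      ENNReal.rpow_ne_top_of_nonneg (by positivity) (by simp)
    calc ‖u x - u y‖ₑ ^ p
        = ‖x - y‖ₑ ^ ((N : ℝ) + s * p) * (‖u x - u y‖ₑ ^ p / ‖x - y‖ₑ ^ ((N : ℝ) + s * p)) :=
          (ENNReal.mul_div_cancel hk0 hkt).symm
      _ ≤ _ := by
          rw [hTr]
          gcongr
          rw [← ofReal_norm]
          refine ENNReal.ofReal_le_ofReal ?_
          rw [Metric.mem_ball, dist_comm, dist_eq_norm] at hy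
          exact hy.le
  have h2 : ∫⁻ y in Metric.ball x r, ‖u y‖ₑ ^ p ≤ B * (T * ν) ^ θ := by
    refine (lintegral_rpow_le_rpow_mul_measure hu.restrict hp0
      (le_pStar hN hp0 hs hsp)).trans ?_
    rw [Measure.restrict_apply_univ, hV, div_pStar hN hp0 hsp, hB, div_pStar hN hp0 hsp]
    rw [show 1 - (1 - s * p / N) = θ by rw [hθ]; ring]
    gcongr
    · have : s * p / N < 1 := (div_lt_one hN).2 hsp
      linarith
    · exact Measure.restrict_le_self
  have h3 : ‖u x‖ₑ ^ p * (T * ν) ≤ 2 ^ (p - 1) * (T ^ (1 + θ) * D + B * (T * ν) ^ θ) := by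
    rw [← hV, ← setLIntegral_const]
    calc ∫⁻ y in Metric.ball x r, ‖u x‖ₑ ^ p
        ≤ ∫⁻ y in Metric.ball x r, 2 ^ (p - 1) * (‖u x - u y‖ₑ ^ p + ‖u y‖ₑ ^ p) := by
          refine lintegral_mono fun y => ?_
          refine le_trans ?_ (ENNReal.rpow_add_le_mul_rpow_add_rpow _ _ hp.le)
          gcongr
          simpa using enorm_add_le (u x - u y) (u y)
      _ = 2 ^ (p - 1) * ((∫⁻ y in Metric.ball x r, ‖u x - u y‖ₑ ^ p) +
            ∫⁻ y in Metric.ball x r, ‖u y‖ₑ ^ p) := by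
          rw [lintegral_const_mul' _ _ (by finiteness),
            lintegral_add_right' _ (hu.restrict.enorm.pow_const p)]
      _ ≤ _ := by rw [hV]; gcongr
  have hTν0 : T * ν ≠ 0 := mul_ne_zero hT0 hν0
  have hTνt : T * ν ≠ ⊤ := ENNReal.mul_ne_top hTt hνt
  have h4 : ‖u x‖ₑ ^ p ≤ 2 ^ (p - 1) * (T ^ (1 + θ) * D + B * (T * ν) ^ θ) / (T * ν) :=
    (ENNReal.le_div_iff_mul_le (Or.inl hTν0) (Or.inl hTνt)).2 h3
  refine h4.trans ?_
  have e1 : T ^ (1 + θ) / (T * ν) = T ^ θ * ν⁻¹ := by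
    rw [ENNReal.rpow_add _ _ hT0 hTt, ENNReal.rpow_one, div_eq_mul_inv,
      ENNReal.mul_inv (Or.inl hT0) (Or.inl hTt)]
    calc T * T ^ θ * (T⁻¹ * ν⁻¹) = (T * T⁻¹) * (T ^ θ * ν⁻¹) := by ring
      _ = _ := by rw [ENNReal.mul_inv_cancel hT0 hTt, one_mul]
  have e2 : (T * ν) ^ θ / (T * ν) = T ^ (θ - 1) * ν ^ (θ - 1) := by
    rw [← ENNReal.mul_rpow_of_ne_top hTt hνt, ENNReal.rpow_sub _ _ hTν0 hTνt, ENNReal.rpow_one]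
  calc 2 ^ (p - 1) * (T ^ (1 + θ) * D + B * (T * ν) ^ θ) / (T * ν)
      = 2 ^ (p - 1) * (T ^ (1 + θ) / (T * ν) * D + B * ((T * ν) ^ θ / (T * ν))) := by
        simp only [div_eq_mul_inv]; ring
    _ = 2 ^ (p - 1) * (ν⁻¹ * (T ^ θ * D) + ν ^ (θ - 1) * (T ^ (θ - 1) * B)) := by
        rw [e1, e2]; ring
    _ ≤ 2 ^ (p - 1) * ((ν⁻¹ + ν ^ (θ - 1)) * (T ^ θ * D) +
          (ν⁻¹ + ν ^ (θ - 1)) * (T ^ (θ - 1) * B)) := by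
        gcongr
        · exact le_self_add
        · exact le_add_self
    _ = _ := by ring

/-- Fractional Sobolev inequality for functions in `L^{p^*}`. -/
lemma sobolev_of_lintegral_ne_top (hN : 0 < (N : ℝ)) (hp : 1 < p) (hs : 0 < s) (hsp : s * p < N)
    {u : EuclideanSpace ℝ (Fin N) → ℝ} (hu : AEStronglyMeasurable u volume)
    (hS : ∫⁻ y, ‖u y‖ₑ ^ pStar N s p ≠ ⊤) :
    (∫⁻ y, ‖u y‖ₑ ^ pStar N s p) ^ (p / pStar N s p) ≤
      sobolevBound N s p * gagliardo s p u := by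
  have hp0 : 0 < p := by linarith
  have hθ0 : 0 < s * p / N := by positivity
  have hθ1 : s * p / N < 1 := (div_lt_one hN).2 hsp
  have hps := pStar_pos hN hp0 hsp
  set S := ∫⁻ y, ‖u y‖ₑ ^ pStar N s p with hSdef
  set c := 2 ^ (p - 1) * ((volume (Metric.ball (0 : EuclideanSpace ℝ (Fin N)) 1))⁻¹ +
        volume (Metric.ball (0 : EuclideanSpace ℝ (Fin N)) 1) ^ (s * p / N - 1)) with hc
  have hct : c ≠ ⊤ := sobolevBound_base_ne_top N s p
  rcases eq_or_ne S 0 with hS0 | hS0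
  · rw [hS0, ENNReal.zero_rpow_of_pos (by positivity)]; exact zero_le
  obtain ⟨B, hB⟩ : ∃ B, B = S ^ (p / pStar N s p) := ⟨_, rfl⟩
  rw [← hB]
  have hB0 : B ≠ 0 := hB ▸ (ENNReal.rpow_pos (pos_iff_ne_zero.2 hS0) hS).ne'
  have hBt : B ≠ ⊤ := hB ▸ ENNReal.rpow_ne_top_of_nonneg (by positivity) hS
  set D : EuclideanSpace ℝ (Fin N) → ℝ≥0∞ :=
    fun x => ∫⁻ y, ‖u x - u y‖ₑ ^ p / ‖x - y‖ₑ ^ ((N : ℝ) + s * p) with hD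
  set θ := s * p / N with hθ
  have hθ' : 0 < 1 - θ := by linarith
  have hdiv : p / pStar N s p = 1 - θ := div_pStar hN hp0 hsp
  have hpw : ∀ x, ‖u x‖ₑ ^ pStar N s p ≤
      sobolevBound N s p * B ^ (θ / (1 - θ)) * D x := by
    intro x
    have h1 : ‖u x‖ₑ ^ p ≤ 2 * c * (B ^ θ * D x ^ (1 - θ)) :=
      le_of_forall_scale hθ1 hct hB0 hBt fun t ht =>
        hB ▸ enorm_rpow_le_scale hN hp hs hsp hu x ht
    -- The power 1/(1 - θ) = p*/p turns p into p* and makes D x appear linearly, so that it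
    -- integrates to the energy.
    have h2 := ENNReal.rpow_le_rpow h1 (one_div_nonneg.2 hθ'.le)
    rw [← ENNReal.rpow_mul, ENNReal.mul_rpow_of_nonneg (2 * c) _ (one_div_nonneg.2 hθ'.le),
      ENNReal.mul_rpow_of_nonneg (B ^ θ) _ (one_div_nonneg.2 hθ'.le), ← ENNReal.rpow_mul,
      ← ENNReal.rpow_mul, mul_one_div_cancel hθ'.ne', ENNReal.rpow_one, ← mul_assoc] at h2
    have e : p * (1 / (1 - θ)) = pStar N s p := by
      rw [← hdiv]; field_simp
    rw [e, mul_one_div] at h2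
    exact h2
  have hint : ∫⁻ x, D x = gagliardo s p u :=
    (lintegral_prod _ (aemeasurable_gagliardo_integrand hu _)).symm
  have hle : S ≤ sobolevBound N s p * B ^ (θ / (1 - θ)) * gagliardo s p u := by
    rw [← hint, ← lintegral_const_mul' _ _ (ENNReal.mul_ne_top (sobolevBound_ne_top hN hsp)
      (ENNReal.rpow_ne_top_of_nonneg (by positivity) hBt))]
    exact lintegral_mono hpw
  -- Absorption: S is B^{1/(1-θ)}, so B^{θ/(1-θ)} cancels from both sides. The cancellation needs S
  -- finite, hence the assumption that u lies in L^{p*}.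
  have hSB : S = B ^ (θ / (1 - θ)) * B := by
    calc S = B ^ (θ / (1 - θ) + 1) := ?_
      _ = _ := by rw [ENNReal.rpow_add _ _ hB0 hBt, ENNReal.rpow_one]
    rw [hB, ← ENNReal.rpow_mul, hdiv]
    rw [show (1 - θ) * (θ / (1 - θ) + 1) = 1 by field_simp; ring, ENNReal.rpow_one]
  have hE0 : B ^ (θ / (1 - θ)) ≠ 0 := (ENNReal.rpow_pos (pos_iff_ne_zero.2 hB0) hBt).ne'
  have hEt : B ^ (θ / (1 - θ)) ≠ ⊤ := ENNReal.rpow_ne_top_of_nonneg (by positivity) hBt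
  rw [hSB] at hle
  have hle' : B ^ (θ / (1 - θ)) * B ≤
      B ^ (θ / (1 - θ)) * (sobolevBound N s p * gagliardo s p u) := by
    refine hle.trans (le_of_eq ?_); ring
  exact (ENNReal.mul_le_mul_iff_right hE0 hEt).1 hle'

lemma testFun_continuous {Ω : Set (EuclideanSpace ℝ (Fin N))} {φ : EuclideanSpace ℝ (Fin N) → ℝ}
    (hφ : φ ∈ testFun Ω) : Continuous φ := hφ.1.continuous

lemma lintegral_testFun_ne_top {Ω : Set (EuclideanSpace ℝ (Fin N))}
    {φ : EuclideanSpace ℝ (Fin N) → ℝ} (hφ : φ ∈ testFun Ω) {a : ℝ} (ha : 0 < a) :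
    ∫⁻ y, ‖φ y‖ₑ ^ a ≠ ⊤ := by
  have h : MemLp φ (ENNReal.ofReal a) volume :=
    (testFun_continuous hφ).memLp_of_hasCompactSupport hφ.2.1
  have := lintegral_rpow_enorm_lt_top_of_eLpNorm_lt_top (by simpa using ha) (by simp) h.2
  rw [ENNReal.toReal_ofReal ha.le] at this
  exact this.ne

lemma exists_subseq_ae_of_eLpNorm (hp : 0 < p) {v : EuclideanSpace ℝ (Fin N) → ℝ}
    {φ : ℕ → EuclideanSpace ℝ (Fin N) → ℝ} (hv : AEStronglyMeasurable v volume)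
    (hφ : ∀ n, AEStronglyMeasurable (φ n) volume)
    (h : Tendsto (fun n => eLpNorm (v - φ n) (ENNReal.ofReal p) volume) atTop (𝓝 0)) :
    ∃ ns : ℕ → ℕ, StrictMono ns ∧ ∀ᵐ x, Tendsto (fun i => φ (ns i) x) atTop (𝓝 (v x)) := by
  refine (tendstoInMeasure_of_tendsto_eLpNorm (p := ENNReal.ofReal p) (by simpa using hp) hφ hv
    ?_).exists_seq_tendsto_ae
  simpa only [eLpNorm_sub_comm] using h

/-- Fatou along an a.e. convergent subsequence of test functions, whose L^{p*} norms are finite. The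
factor 2^{p-1} is the price of the quasi-triangle inequality and is harmless: only finiteness of the
constant is needed. -/
lemma sobolev_W0 (hN : 0 < (N : ℝ)) (hp : 1 < p) (hs : 0 < s) (hsp : s * p < N)
    {v : EuclideanSpace ℝ (Fin N) → ℝ} (hv : v ∈ W0 N s p) :
    (∫⁻ y, ‖v y‖ₑ ^ pStar N s p) ^ (p / pStar N s p) ≤
      sobolevBound N s p * (2 ^ (p - 1) * gagliardo s p v) := by
  have hp0 : 0 < p := by linarith
  have hps := pStar_pos hN hp0 hsp
  obtain ⟨hvm, φ, hφ, hL, hG⟩ := hv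
  have hφm : ∀ n, AEStronglyMeasurable (φ n) volume := fun n =>
    (testFun_continuous (hφ n)).aestronglyMeasurable
  obtain ⟨ns, hns, hae⟩ := exists_subseq_ae_of_eLpNorm hp0 hvm hφm hL
  have hfatou : ∫⁻ y, ‖v y‖ₑ ^ pStar N s p ≤
      liminf (fun i => ∫⁻ y, ‖φ (ns i) y‖ₑ ^ pStar N s p) atTop := by
    calc ∫⁻ y, ‖v y‖ₑ ^ pStar N s p
        = ∫⁻ y, liminf (fun i => ‖φ (ns i) y‖ₑ ^ pStar N s p) atTop := by
          refine lintegral_congr_ae ?_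
          filter_upwards [hae] with y hy
          exact (((ENNReal.continuous_rpow_const.tendsto _).comp hy.enorm).liminf_eq).symm
      _ ≤ _ := lintegral_liminf_le' fun i => (hφm _).enorm.pow_const _
  have hb : ∀ i, ∫⁻ y, ‖φ (ns i) y‖ₑ ^ pStar N s p ≤ (sobolevBound N s p * (2 ^ (p - 1) *
      (gagliardo s p v + gagliardo s p (v - φ (ns i))))) ^ (pStar N s p / p) := by
    intro i
    have h1 := sobolev_of_lintegral_ne_top hN hp hs hsp (hφm (ns i))
      (lintegral_testFun_ne_top (hφ (ns i)) hps)
    have h2 : gagliardo s p (φ (ns i)) ≤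
        2 ^ (p - 1) * (gagliardo s p v + gagliardo s p (v - φ (ns i))) := by
      simpa using gagliardo_sub_le (s := s) (v := v - φ (ns i)) hp.le hvm
    have h3 := ENNReal.rpow_le_rpow (h1.trans (mul_le_mul_right h2 _))
      (by positivity : 0 ≤ pStar N s p / p)
    rw [← ENNReal.rpow_mul] at h3
    rwa [show p / pStar N s p * (pStar N s p / p) = 1 by field_simp, ENNReal.rpow_one] at h3
  have hlim : Tendsto (fun i => (sobolevBound N s p * (2 ^ (p - 1) *
      (gagliardo s p v + gagliardo s p (v - φ (ns i))))) ^ (pStar N s p / p)) atTop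
      (𝓝 ((sobolevBound N s p * (2 ^ (p - 1) * (gagliardo s p v + 0))) ^ (pStar N s p / p))) := by
    refine (ENNReal.continuous_rpow_const.tendsto _).comp ?_
    refine ENNReal.Tendsto.const_mul ?_ (Or.inr (sobolevBound_ne_top hN hsp))
    refine ENNReal.Tendsto.const_mul ?_ (Or.inr (by finiteness))
    exact tendsto_const_nhds.add (hG.comp hns.tendsto_atTop)
  have hfin : ∫⁻ y, ‖v y‖ₑ ^ pStar N s p ≤
      (sobolevBound N s p * (2 ^ (p - 1) * gagliardo s p v)) ^ (pStar N s p / p) := by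
    rw [add_zero] at hlim
    rw [← hlim.liminf_eq]
    exact hfatou.trans (liminf_le_liminf (Eventually.of_forall hb))
  have := ENNReal.rpow_le_rpow hfin (by positivity : 0 ≤ p / pStar N s p)
  rwa [← ENNReal.rpow_mul (_ * _), show pStar N s p / p * (p / pStar N s p) = 1 by field_simp,
    ENNReal.rpow_one] at this

/-- The sharp Sobolev constant is finite. -/
theorem sobolevConst_lt_top (hN : 0 < (N : ℝ)) (hp : 1 < p) (hs : 0 < s) (hsp : s * p < N) :
    sobolevConst N s p < ⊤ := by
  refine lt_of_le_of_lt (iSup₂_le fun v hv => ?_)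
    (b := sobolevBound N s p * 2 ^ (p - 1))
    (ENNReal.mul_lt_top (sobolevBound_ne_top hN hsp).lt_top (by finiteness))
  have := sobolev_W0 hN hp hs hsp hv.1
  rwa [hv.2, mul_one] at this

end Sobolev

/-! ### Poincaré inequality; finite energy of test functions -/

section TestFunctions

variable {N : ℕ} {s p : ℝ}

/-- Fractional Poincaré inequality for functions vanishing outside a bounded set. -/
lemma exists_poincare (hN : 0 < (N : ℝ)) (hp : 1 < p) (hs : 0 < s)
    {Ω : Set (EuclideanSpace ℝ (Fin N))} (hΩ : Bornology.IsBounded Ω) :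
    ∃ C : ℝ≥0∞, C ≠ ⊤ ∧ ∀ w : EuclideanSpace ℝ (Fin N) → ℝ, AEStronglyMeasurable w volume →
      (∀ᵐ x, x ∉ Ω → w x = 0) → ∫⁻ x, ‖w x‖ₑ ^ p ≤ C * gagliardo s p w := by
  have hp0 : 0 < p := by linarith
  have : Nonempty (Fin N) := ⟨⟨0, by exact_mod_cast hN⟩⟩
  obtain ⟨R, hR0, hR⟩ := hΩ.subset_ball_lt 0 0
  -- The unit ball about a point of norm R + 1 misses Ω ⊆ B(0, R), so w vanishes a.e. there and
  -- |w(x)| is itself an increment. Distances between the two sets are at most R + (R + 2).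
  obtain ⟨y₀, hy₀⟩ := exists_norm_eq (EuclideanSpace ℝ (Fin N)) (c := R + 1) (by linarith)
  set A := Metric.ball y₀ 1 with hA
  have hA0 : volume A ≠ 0 := (Metric.measure_ball_pos _ _ one_pos).ne'
  have hAt : volume A ≠ ⊤ := measure_ball_lt_top.ne
  set a : ℝ := (N : ℝ) + s * p with ha
  have ha0 : 0 < a := by positivity
  set M : ℝ≥0∞ := ENNReal.ofReal (2 * R + 2) ^ a with hM
  have hMt : M ≠ ⊤ := ENNReal.rpow_ne_top_of_nonneg ha0.le ENNReal.ofReal_ne_top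
  refine ⟨(volume A)⁻¹ * M, ENNReal.mul_ne_top (by simpa using hA0) hMt, fun w hw hw0 => ?_⟩
  have hnot : ∀ y ∈ A, y ∉ Ω := by
    intro y hy hyΩ
    have h1 : ‖y‖ < R := by simpa using hR hyΩ
    have h2 : ‖y - y₀‖ < 1 := by simpa [hA, dist_eq_norm] using hy
    have h3 : ‖y₀‖ ≤ ‖y‖ + ‖y - y₀‖ := by
      simpa using norm_sub_le y (y - y₀)
    linarith
  have key : ∀ᵐ x, volume A * ‖w x‖ₑ ^ p ≤
      M * ∫⁻ y, ‖w x - w y‖ₑ ^ p / ‖x - y‖ₑ ^ a := by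
    filter_upwards [hw0] with x hx
    by_cases hxΩ : x ∈ Ω
    · rw [mul_comm, ← setLIntegral_const, ← lintegral_const_mul' _ _ hMt]
      refine (lintegral_mono_ae ?_).trans (setLIntegral_le_lintegral A _)
      rw [ae_restrict_iff' measurableSet_ball]
      filter_upwards [hw0] with y hy hyA
      rw [hy (hnot y hyA), sub_zero]
      have hx1 : ‖x‖ < R := by simpa using hR hxΩ
      have hy1 : ‖y - y₀‖ < 1 := by simpa [hA, dist_eq_norm] using hyA
      have hxy : x ≠ y := fun h => hnot y hyA (h ▸ hxΩ)
      have hk0 : ‖x - y‖ₑ ^ a ≠ 0 :=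
        (ENNReal.rpow_pos (by simpa [sub_eq_zero] using hxy) (by simp)).ne'
      have hkt : ‖x - y‖ₑ ^ a ≠ ⊤ := ENNReal.rpow_ne_top_of_nonneg ha0.le (by simp)
      calc ‖w x‖ₑ ^ p = ‖x - y‖ₑ ^ a * (‖w x‖ₑ ^ p / ‖x - y‖ₑ ^ a) :=
            (ENNReal.mul_div_cancel hk0 hkt).symm
        _ ≤ _ := by
            rw [hM]
            gcongr
            rw [← ofReal_norm]
            refine ENNReal.ofReal_le_ofReal ?_
            have h4 : ‖x - y‖ ≤ ‖x‖ + ‖y‖ := norm_sub_le _ _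
            have h5 : ‖y‖ ≤ ‖y - y₀‖ + ‖y₀‖ := by simpa using norm_add_le (y - y₀) y₀
            linarith
    · simp [hx hxΩ, hp0]
  have h1 : volume A * ∫⁻ x, ‖w x‖ₑ ^ p ≤ M * gagliardo s p w := by
    rw [← lintegral_const_mul' _ _ hAt]
    unfold gagliardo
    rw [Measure.volume_eq_prod, lintegral_prod _ (aemeasurable_gagliardo_integrand hw _),
      ← lintegral_const_mul' _ _ hMt]
    exact lintegral_mono_ae key
  calc ∫⁻ x, ‖w x‖ₑ ^ p = (volume A)⁻¹ * (volume A * ∫⁻ x, ‖w x‖ₑ ^ p) := by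
        rw [← mul_assoc, ENNReal.inv_mul_cancel hA0 hAt, one_mul]
    _ ≤ (volume A)⁻¹ * (M * gagliardo s p w) := by gcongr
    _ = _ := by rw [mul_assoc]

/-- In polar coordinates the integrand is at most a multiple of r^{p(1-s)-1} near 0, integrable
since s < 1, and of r^{-sp-1} at infinity, integrable since s > 0. -/
lemma integrable_min_rpow_div (hN : 0 < (N : ℝ)) (hp : 1 < p) (hs : 0 < s) (hs1 : s < 1)
    {c M : ℝ} (hc : 0 ≤ c) (hM : 0 ≤ M) :
    Integrable (fun z : EuclideanSpace ℝ (Fin N) =>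
      min (c * ‖z‖) M ^ p / ‖z‖ ^ ((N : ℝ) + s * p)) volume := by
  have hp0 : 0 < p := by linarith
  have hN' : 1 ≤ N := by exact_mod_cast hN
  have : Nonempty (Fin N) := ⟨⟨0, hN'⟩⟩
  rw [integrable_fun_norm_addHaar volume
    (f := fun r : ℝ => min (c * r) M ^ p / r ^ ((N : ℝ) + s * p)), finrank_euclideanSpace_fin]
  have hmeas : Measurable (fun y : ℝ => y ^ (N - 1) • (min (c * y) M ^ p / y ^ ((N : ℝ) + s * p))) := by
    fun_prop
  have hpow : ∀ y : ℝ, 0 < y → y ^ (N - 1) = y ^ ((N : ℝ) - 1) := fun y hy => by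
    rw [← Real.rpow_natCast, Nat.cast_sub hN', Nat.cast_one]
  rw [← Set.Ioc_union_Ioi_eq_Ioi zero_le_one, integrableOn_union]
  constructor
  · have h1 : IntegrableOn (fun y : ℝ => c ^ p * y ^ (p * (1 - s) - 1)) (Set.Ioc 0 1) := by
      refine Integrable.const_mul ?_ _
      have := intervalIntegral.intervalIntegrable_rpow' (a := 0) (b := 1)
        (r := p * (1 - s) - 1) (by nlinarith)
      rwa [intervalIntegrable_iff_integrableOn_Ioc_of_le zero_le_one] at this
    refine Integrable.mono' h1 hmeas.aestronglyMeasurable ?_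
    refine (ae_restrict_iff' measurableSet_Ioc).2 (ae_of_all _ fun y hy => ?_)
    have hy0 : 0 < y := hy.1
    have hmin : 0 ≤ min (c * y) M := le_min (by positivity) hM
    rw [smul_eq_mul, Real.norm_of_nonneg (by positivity), hpow y hy0]
    calc y ^ ((N : ℝ) - 1) * (min (c * y) M ^ p / y ^ ((N : ℝ) + s * p))
        ≤ y ^ ((N : ℝ) - 1) * ((c * y) ^ p / y ^ ((N : ℝ) + s * p)) := by
          gcongr
          exact min_le_left _ _
      _ = c ^ p * (y ^ ((N : ℝ) - 1) * y ^ p / y ^ ((N : ℝ) + s * p)) := by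
          rw [Real.mul_rpow hc hy0.le]; ring
      _ = _ := by
          rw [← Real.rpow_add hy0, ← Real.rpow_sub hy0]
          congr 2; ring
  · have h1 : IntegrableOn (fun y : ℝ => M ^ p * y ^ (-(s * p) - 1)) (Set.Ioi 1) :=
      Integrable.const_mul (integrableOn_Ioi_rpow_of_lt (by nlinarith) one_pos) _
    refine Integrable.mono' h1 hmeas.aestronglyMeasurable ?_
    refine (ae_restrict_iff' measurableSet_Ioi).2 (ae_of_all _ fun y hy => ?_)
    have hy0 : 0 < y := one_pos.trans hy
    have hmin : 0 ≤ min (c * y) M := le_min (by positivity) hM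
    rw [smul_eq_mul, Real.norm_of_nonneg (by positivity), hpow y hy0]
    calc y ^ ((N : ℝ) - 1) * (min (c * y) M ^ p / y ^ ((N : ℝ) + s * p))
        ≤ y ^ ((N : ℝ) - 1) * (M ^ p / y ^ ((N : ℝ) + s * p)) := by
          gcongr
          exact min_le_right _ _
      _ = M ^ p * (y ^ ((N : ℝ) - 1) / y ^ ((N : ℝ) + s * p)) := by ring
      _ = _ := by
          rw [← Real.rpow_sub hy0]
          congr 2; ring

/-- Test functions have finite Gagliardo energy. -/
lemma gagliardo_testFun_ne_top (hN : 0 < (N : ℝ)) (hp : 1 < p) (hs : 0 < s) (hs1 : s < 1)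
    {Ω : Set (EuclideanSpace ℝ (Fin N))} {φ : EuclideanSpace ℝ (Fin N) → ℝ}
    (hφ : φ ∈ testFun Ω) : gagliardo s p φ ≠ ⊤ := by
  have hp0 : 0 < p := by linarith
  obtain ⟨c, hc⟩ := hφ.1.lipschitzWith_of_hasCompactSupport hφ.2.1 (by simp)
  obtain ⟨M, hM⟩ := hφ.2.1.exists_bound_of_continuous hφ.1.continuous
  have hM0 : 0 ≤ M := (norm_nonneg _).trans (hM 0)
  set a : ℝ := (N : ℝ) + s * p with ha
  set H : EuclideanSpace ℝ (Fin N) → ℝ≥0∞ := fun z =>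
    ENNReal.ofReal (min (c * ‖z‖) (2 * M) ^ p / ‖z‖ ^ a) with hH
  have hHm : Measurable H := by
    simp only [hH]; fun_prop
  have hHfin : ∫⁻ z, H z ≠ ⊤ :=
    (integrable_min_rpow_div hN hp hs hs1 c.2 (by linarith)).lintegral_lt_top.ne
  set K := tsupport φ with hK
  have hKm : MeasurableSet K := (isClosed_tsupport φ).measurableSet
  have hKt : volume K ≠ ⊤ := hφ.2.1.isCompact.measure_lt_top.ne
  -- An increment vanishes unless one endpoint lies in K; otherwise the Lipschitz bound and the
  -- bound 2M give H(x - y), and translation invariance decouples the integrals.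
  have hpt : ∀ z : EuclideanSpace ℝ (Fin N) × EuclideanSpace ℝ (Fin N),
      ‖φ z.1 - φ z.2‖ₑ ^ p / ‖z.1 - z.2‖ₑ ^ a ≤
        K.indicator 1 z.1 * H (z.1 - z.2) + K.indicator 1 z.2 * H (z.1 - z.2) := by
    rintro ⟨x, y⟩
    rcases eq_or_ne x y with rfl | hxy
    · simp [hp0]
    have hxy0 : 0 < ‖x - y‖ := by simpa [sub_eq_zero] using hxy
    have hb : ‖φ x - φ y‖ₑ ^ p / ‖x - y‖ₑ ^ a ≤ H (x - y) := by
      simp only [hH]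
      rw [← ofReal_norm, ← ofReal_norm, ENNReal.ofReal_rpow_of_nonneg (norm_nonneg _) hp0.le,
        ENNReal.ofReal_rpow_of_pos hxy0, ← ENNReal.ofReal_div_of_pos (by positivity)]
      refine ENNReal.ofReal_le_ofReal ?_
      gcongr
      refine le_min (by simpa [dist_eq_norm] using hc.dist_le_mul x y) ?_
      linarith [norm_sub_le (φ x) (φ y), hM x, hM y]
    by_cases hx : x ∈ K
    · simp only [Set.indicator_of_mem hx, Pi.one_apply, one_mul]
      exact hb.trans le_self_add
    by_cases hy : y ∈ K
    · simp only [Set.indicator_of_mem hy, Pi.one_apply, one_mul]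
      exact hb.trans le_add_self
    · simp [image_eq_zero_of_notMem_tsupport hx, image_eq_zero_of_notMem_tsupport hy, hp0]
  have hind : Measurable (K.indicator (1 : EuclideanSpace ℝ (Fin N) → ℝ≥0∞)) :=
    measurable_one.indicator hKm
  have hm1 : Measurable (fun z : EuclideanSpace ℝ (Fin N) × EuclideanSpace ℝ (Fin N) =>
      K.indicator (1 : EuclideanSpace ℝ (Fin N) → ℝ≥0∞) z.1 * H (z.1 - z.2)) := by fun_prop
  have hm2 : Measurable (fun z : EuclideanSpace ℝ (Fin N) × EuclideanSpace ℝ (Fin N) =>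
      K.indicator (1 : EuclideanSpace ℝ (Fin N) → ℝ≥0∞) z.2 * H (z.1 - z.2)) := by fun_prop
  refine ne_top_of_le_ne_top ?_ (lintegral_mono hpt)
  rw [lintegral_add_left hm1, Measure.volume_eq_prod, lintegral_prod _ hm1.aemeasurable,
    lintegral_prod_symm _ hm2.aemeasurable]
  have hind1 : ∀ x, K.indicator (1 : EuclideanSpace ℝ (Fin N) → ℝ≥0∞) x ≠ ⊤ := fun x => by
    by_cases hx : x ∈ K <;> simp [hx]
  have e1 : ∀ x : EuclideanSpace ℝ (Fin N), ∫⁻ y, K.indicator 1 x * H (x - y) =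
      K.indicator 1 x * ∫⁻ z, H z := fun x => by
    rw [lintegral_const_mul' _ _ (hind1 x), lintegral_sub_left_eq_self]
  have e2 : ∀ y : EuclideanSpace ℝ (Fin N), ∫⁻ x, K.indicator 1 y * H (x - y) =
      K.indicator 1 y * ∫⁻ z, H z := fun y => by
    rw [lintegral_const_mul' _ _ (hind1 y), lintegral_sub_right_eq_self]
  simp only [e1, e2]
  rw [lintegral_mul_const' _ _ hHfin, lintegral_indicator_one hKm]
  exact ENNReal.add_ne_top.2 ⟨ENNReal.mul_ne_top hKt hHfin, ENNReal.mul_ne_top hKt hHfin⟩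

end TestFunctions

/-! ### The zero-boundary space: sharp Sobolev inequality and stability under truncation -/

section TildeSpace

variable {N : ℕ} {s p : ℝ} {Ω : Set (EuclideanSpace ℝ (Fin N))}
  {u : EuclideanSpace ℝ (Fin N) → ℝ}

lemma eLpNorm_ofReal_eq {α : Type*} [MeasurableSpace α] {μ : Measure α} {f : α → ℝ} {a : ℝ}
    (ha : 0 < a) : eLpNorm f (ENNReal.ofReal a) μ = (∫⁻ x, ‖f x‖ₑ ^ a ∂μ) ^ (1 / a) := by
  rw [eLpNorm_eq_lintegral_rpow_enorm_toReal (by simpa using ha) (by simp),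
    ENNReal.toReal_ofReal ha.le]

lemma testFun_eq_zero {φ : EuclideanSpace ℝ (Fin N) → ℝ} (hφ : φ ∈ testFun Ω)
    {x : EuclideanSpace ℝ (Fin N)} (hx : x ∉ Ω) : φ x = 0 :=
  image_eq_zero_of_notMem_tsupport fun h => hx (hφ.2.2 h)

lemma gagliardo_ne_top_of_mem_tildeW0 (hN : 0 < (N : ℝ)) (hp : 1 < p) (hs : 0 < s) (hs1 : s < 1)
    (hu : u ∈ tildeW0 s p Ω) : gagliardo s p u ≠ ⊤ := by
  obtain ⟨hum, -, φ, hφ, hlim⟩ := hu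
  obtain ⟨n, hn⟩ := (hlim.eventually (gt_mem_nhds ENNReal.zero_lt_top)).exists
  have h := gagliardo_add_le (s := s) (u := u - φ n) (v := φ n) hp.le
    (hum.sub (testFun_continuous (hφ n)).aestronglyMeasurable)
  rw [sub_add_cancel] at h
  exact ne_top_of_le_ne_top (ENNReal.mul_ne_top (by finiteness)
    (ENNReal.add_ne_top.2 ⟨hn.ne, gagliardo_testFun_ne_top hN hp hs hs1 (hφ n)⟩)) h

lemma tendsto_eLpNorm_of_gagliardo (hN : 0 < (N : ℝ)) (hp : 1 < p) (hs : 0 < s)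
    (hΩ : Bornology.IsBounded Ω) (hum : AEStronglyMeasurable u volume)
    (hu0 : ∀ᵐ x, x ∉ Ω → u x = 0) {φ : ℕ → EuclideanSpace ℝ (Fin N) → ℝ}
    (hφ : ∀ n, φ n ∈ testFun Ω) (hlim : Tendsto (fun n => gagliardo s p (u - φ n)) atTop (𝓝 0)) :
    Tendsto (fun n => eLpNorm (u - φ n) (ENNReal.ofReal p) volume) atTop (𝓝 0) := by
  have hp0 : 0 < p := by linarith
  obtain ⟨C, hC, hpoin⟩ := exists_poincare hN hp hs hΩ
  have hb : ∀ n, eLpNorm (u - φ n) (ENNReal.ofReal p) volume ≤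
      (C * gagliardo s p (u - φ n)) ^ (1 / p) := fun n => by
    rw [eLpNorm_ofReal_eq hp0]
    refine ENNReal.rpow_le_rpow (hpoin _ (hum.sub
      (testFun_continuous (hφ n)).aestronglyMeasurable) ?_) (by positivity)
    filter_upwards [hu0] with x hx hxΩ
    simp [hx hxΩ, testFun_eq_zero (hφ n) hxΩ]
  refine tendsto_of_tendsto_of_tendsto_of_le_of_le tendsto_const_nhds ?_ (fun _ => zero_le) hb
  have h1 := ENNReal.Tendsto.const_mul (a := C) hlim (Or.inr hC)
  have h2 := (ENNReal.continuous_rpow_const (y := 1 / p)).tendsto (C * 0) |>.comp h1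
  have h3 : ((C * 0 : ℝ≥0∞)) ^ (1 / p) = 0 := by
    rw [mul_zero, ENNReal.zero_rpow_of_pos (by positivity)]
  rwa [h3] at h2

lemma tildeW0_subset_W0 (hN : 0 < (N : ℝ)) (hp : 1 < p) (hs : 0 < s)
    (hΩ : Bornology.IsBounded Ω) : tildeW0 s p Ω ⊆ W0 N s p := by
  rintro u ⟨hum, hu0, φ, hφ, hlim⟩
  exact ⟨hum, φ, fun n => ⟨(hφ n).1, (hφ n).2.1, Set.subset_univ _⟩,
    tendsto_eLpNorm_of_gagliardo hN hp hs hΩ hum hu0 hφ hlim, hlim⟩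

lemma const_smul_mem_W0 (hp : 0 ≤ p) (c : ℝ) (hu : u ∈ W0 N s p) : c • u ∈ W0 N s p := by
  obtain ⟨hum, φ, hφ, hL, hG⟩ := hu
  refine ⟨hum.const_smul c, fun n => c • φ n, fun n => ⟨(hφ n).1.const_smul c,
    (hφ n).2.1.mono fun x hx => ?_, Set.subset_univ _⟩, ?_, ?_⟩
  · simp only [Function.mem_support, Pi.smul_apply, smul_eq_mul] at hx ⊢
    exact right_ne_zero_of_mul hx
  · simp_rw [← smul_sub, eLpNorm_const_smul]
    simpa using ENNReal.Tendsto.const_mul (a := ‖c‖ₑ) hL (Or.inr (by simp))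
  · simp_rw [← smul_sub, gagliardo_const_smul hp]
    simpa using ENNReal.Tendsto.const_mul (a := ‖c‖ₑ ^ p) hG (Or.inr (by finiteness))

/-- The Sobolev inequality with the sharp constant, for functions vanishing outside `Ω`. -/
lemma sobolev_tildeW0 (hN : 0 < (N : ℝ)) (hp : 1 < p) (hs : 0 < s) (hs1 : s < 1)
    (hsp : s * p < N) (hΩ : Bornology.IsBounded Ω) (hu : u ∈ tildeW0 s p Ω) :
    (∫⁻ y, ‖u y‖ₑ ^ pStar N s p) ^ (p / pStar N s p) ≤
      sobolevConst N s p * gagliardo s p u := by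
  have hp0 : 0 < p := by linarith
  have hps := pStar_pos hN hp0 hsp
  have hGt := gagliardo_ne_top_of_mem_tildeW0 hN hp hs hs1 hu
  rcases eq_or_ne (gagliardo s p u) 0 with hG0 | hG0
  -- Zero energy cannot be normalized to 1, so the supremum says nothing; Poincaré forces u = 0 a.e.
  · obtain ⟨C, hC, hpoin⟩ := exists_poincare hN hp hs hΩ
    have h1 := hpoin u hu.1 hu.2.1
    rw [hG0, mul_zero, nonpos_iff_eq_zero, lintegral_eq_zero_iff' (hu.1.enorm.pow_const p)] at h1
    have h2 : ∫⁻ y, ‖u y‖ₑ ^ pStar N s p = 0 := by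
      rw [lintegral_eq_zero_iff' (hu.1.enorm.pow_const _)]
      filter_upwards [h1] with x hx
      have : u x = 0 := by simpa [hp0, hp0.not_gt] using hx
      simp [this, hps]
    rw [h2, ENNReal.zero_rpow_of_pos (by positivity)]
    exact zero_le
  set g := (gagliardo s p u).toReal with hg
  have hg0 : 0 < g := ENNReal.toReal_pos hG0 hGt
  set c : ℝ := g ^ (-(1 / p)) with hc
  have hc0 : 0 < c := by positivity
  have hcp : ‖c‖ₑ ^ p = (gagliardo s p u)⁻¹ := by
    rw [Real.enorm_eq_ofReal hc0.le, ENNReal.ofReal_rpow_of_pos hc0, hc, ← Real.rpow_mul hg0.le,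
      show -(1 / p) * p = -1 by field_simp, Real.rpow_neg_one, ENNReal.ofReal_inv_of_pos hg0, hg,
      ENNReal.ofReal_toReal hGt]
  have h1 : gagliardo s p (c • u) = 1 := by
    rw [gagliardo_const_smul hp0.le, hcp, ENNReal.inv_mul_cancel hG0 hGt]
  have h2 : (∫⁻ y, ‖(c • u) y‖ₑ ^ pStar N s p) ^ (p / pStar N s p) ≤ sobolevConst N s p :=
    le_iSup₂_of_le (c • u)
      ⟨const_smul_mem_W0 hp0.le c (tildeW0_subset_W0 hN hp hs hΩ hu), h1⟩ le_rfl
  have h3 : (∫⁻ y, ‖(c • u) y‖ₑ ^ pStar N s p) ^ (p / pStar N s p) =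
      (gagliardo s p u)⁻¹ * (∫⁻ y, ‖u y‖ₑ ^ pStar N s p) ^ (p / pStar N s p) := by
    simp only [Pi.smul_apply, enorm_smul]
    simp_rw [ENNReal.mul_rpow_of_nonneg _ _ hps.le]
    rw [lintegral_const_mul' _ _ (by finiteness),
      ENNReal.mul_rpow_of_nonneg _ _ (by positivity), ← ENNReal.rpow_mul,
      show pStar N s p * (p / pStar N s p) = p by field_simp, hcp]
  rw [h3, mul_comm, ← div_eq_mul_inv, ENNReal.div_le_iff hG0 hGt] at h2
  exact h2

/-- Smoothness of f and f(0) = 0 keep f ∘ φ_n a test function in Ω; the Lipschitz bound lets the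
approximation of u pass to f ∘ u. -/
lemma comp_smooth_mem_tildeW0 (hN : 0 < (N : ℝ)) (hp : 1 < p) (hs : 0 < s) (hs1 : s < 1)
    (hΩ : Bornology.IsBounded Ω) {f : ℝ → ℝ} (hf : ContDiff ℝ ∞ f) (hf0 : f 0 = 0) {c : ℝ}
    (hc : 0 ≤ c) (hfc : ∀ a b, |f a - f b| ≤ c * |a - b|) (hu : u ∈ tildeW0 s p Ω) :
    f ∘ u ∈ tildeW0 s p Ω := by
  have hGt := gagliardo_ne_top_of_mem_tildeW0 hN hp hs hs1 hu
  obtain ⟨hum, hu0, φ, hφ, hlim⟩ := hu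
  obtain ⟨ns, hns, hae⟩ := exists_subseq_ae_of_eLpNorm (by linarith) hum
    (fun n => (testFun_continuous (hφ n)).aestronglyMeasurable)
    (tendsto_eLpNorm_of_gagliardo hN hp hs hΩ hum hu0 hφ hlim)
  have hfu := hf.continuous.comp_aestronglyMeasurable hum
  refine ⟨hfu, ?_, fun i => f ∘ φ (ns i), fun i => ⟨hf.comp (hφ _).1, (hφ _).2.1.comp_left hf0,
    (tsupport_comp_subset hf0 _).trans (hφ _).2.2⟩, ?_⟩
  · filter_upwards [hu0] with x hx hxΩ
    simp [hx hxΩ, hf0]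
  · refine tendsto_gagliardo_sub hp.le hc hum hfu (fun i =>
      (hf.continuous.comp (testFun_continuous (hφ (ns i)))).aestronglyMeasurable) hGt
      (hlim.comp hns.tendsto_atTop) (fun x y => hfc _ _) (fun n x y => hfc _ _) ?_
    filter_upwards [hae] with x hx
    exact (hf.continuous.tendsto _).comp hx

/-- Closedness, by choosing for each w_n a test function within energy 1/(n + 1). -/
lemma mem_tildeW0_of_tendsto (hp : 1 < p) (hum : AEStronglyMeasurable u volume)
    (hu0 : ∀ᵐ x, x ∉ Ω → u x = 0) {w : ℕ → EuclideanSpace ℝ (Fin N) → ℝ}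
    (hw : ∀ n, w n ∈ tildeW0 s p Ω)
    (hlim : Tendsto (fun n => gagliardo s p (u - w n)) atTop (𝓝 0)) :
    u ∈ tildeW0 s p Ω := by
  have hex : ∀ n : ℕ, ∃ φ ∈ testFun Ω, gagliardo s p (w n - φ) < ((n : ℝ≥0∞) + 1)⁻¹ := fun n => by
    obtain ⟨-, -, φ, hφ, hφlim⟩ := hw n
    obtain ⟨m, hm⟩ := (hφlim.eventually (gt_mem_nhds
      (ENNReal.inv_pos.2 (by finiteness : (n : ℝ≥0∞) + 1 ≠ ⊤)))).exists
    exact ⟨φ m, hφ m, hm⟩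
  choose φ hφ hφlt using hex
  refine ⟨hum, hu0, φ, hφ, ?_⟩
  have hb : ∀ n, gagliardo s p (u - φ n) ≤
      2 ^ (p - 1) * (gagliardo s p (u - w n) + ((n : ℝ≥0∞) + 1)⁻¹) := fun n => by
    have h := gagliardo_add_le (s := s) (u := u - w n) (v := w n - φ n) hp.le
      (hum.sub (hw n).1)
    rw [sub_add_sub_cancel] at h
    refine h.trans ?_
    gcongr
    exact (hφlt n).le
  refine tendsto_of_tendsto_of_tendsto_of_le_of_le tendsto_const_nhds ?_ (fun _ => zero_le) hb
  have h1 : Tendsto (fun n : ℕ => ((n : ℝ≥0∞) + 1)⁻¹) atTop (𝓝 0) := by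
    have := (tendsto_add_atTop_iff_nat 1).2 ENNReal.tendsto_inv_nat_nhds_zero
    simpa using this
  simpa using ENNReal.Tendsto.const_mul (a := (2 : ℝ≥0∞) ^ (p - 1)) (hlim.add h1)
    (Or.inr (by finiteness))

/-- The soft threshold function `sign t * (|t| - k)₊`. -/
noncomputable def softThreshold (k t : ℝ) : ℝ := t + (|t - k| - |t + k|) / 2

/-- A smooth approximation of the soft threshold function. -/
noncomputable def smoothThreshold (k ε t : ℝ) : ℝ :=
  t + (√((t - k) ^ 2 + ε ^ 2) - √((t + k) ^ 2 + ε ^ 2)) / 2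

lemma continuous_softThreshold (k : ℝ) : Continuous (softThreshold k) := by
  unfold softThreshold; fun_prop

lemma abs_softThreshold {k : ℝ} (hk : 0 ≤ k) (t : ℝ) : |softThreshold k t| = max (|t| - k) 0 := by
  unfold softThreshold
  rcases le_total t (-k) with h1 | h1
  · rw [abs_of_nonpos (by linarith : t - k ≤ 0), abs_of_nonpos (by linarith : t + k ≤ 0),
      abs_of_nonpos (by linarith : t ≤ 0), max_eq_left (by linarith), abs_of_nonpos (by linarith)]
    ring
  rcases le_total t k with h2 | h2
  · rw [abs_of_nonpos (by linarith : t - k ≤ 0), abs_of_nonneg (by linarith : 0 ≤ t + k),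
      max_eq_right (by linarith [abs_le.2 ⟨h1, h2⟩]), abs_eq_zero]
    ring
  · rw [abs_of_nonneg (by linarith : 0 ≤ t - k), abs_of_nonneg (by linarith : 0 ≤ t + k),
      abs_of_nonneg (by linarith : 0 ≤ t), max_eq_left (by linarith), abs_of_nonneg (by linarith)]
    ring

lemma softThreshold_sub_sign {k : ℝ} (hk : 0 ≤ k) {a b : ℝ} (h : b ≤ a) :
    0 ≤ softThreshold k a - softThreshold k b ∧
      softThreshold k a - softThreshold k b ≤ a - b := by
  unfold softThreshold
  constructor <;>
  cases abs_cases (a - k) <;> cases abs_cases (a + k) <;> cases abs_cases (b - k) <;>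
    cases abs_cases (b + k) <;> linarith

lemma abs_softThreshold_sub_le {k : ℝ} (hk : 0 ≤ k) (a b : ℝ) :
    |softThreshold k a - softThreshold k b| ≤ |a - b| := by
  rcases le_total b a with h | h
  · obtain ⟨h1, h2⟩ := softThreshold_sub_sign hk h
    rw [abs_of_nonneg h1, abs_of_nonneg (by linarith)]; exact h2
  · obtain ⟨h1, h2⟩ := softThreshold_sub_sign hk h
    rw [abs_sub_comm, abs_sub_comm a, abs_of_nonneg h1, abs_of_nonneg (by linarith)]; exact h2

lemma mul_softThreshold_sub {k : ℝ} (hk : 0 ≤ k) (a b : ℝ) :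
    (a - b) * (softThreshold k a - softThreshold k b) =
      |a - b| * |softThreshold k a - softThreshold k b| := by
  rw [← abs_mul, abs_of_nonneg]
  rcases le_total b a with h | h
  · exact mul_nonneg (by linarith) (softThreshold_sub_sign hk h).1
  · exact mul_nonneg_of_nonpos_of_nonpos (by linarith)
      (by linarith [(softThreshold_sub_sign hk h).1])

/-- Reverse triangle inequality for the planar vectors (a, e) and (b, e). -/
lemma abs_sqrt_sq_add_sub_le (e a b : ℝ) :
    |√(a ^ 2 + e ^ 2) - √(b ^ 2 + e ^ 2)| ≤ |a - b| := by
  have h := abs_norm_sub_norm_le (!₂[a, e] : EuclideanSpace ℝ (Fin 2)) !₂[b, e]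
  simpa [EuclideanSpace.norm_eq, Fin.sum_univ_two, Real.sqrt_sq_eq_abs] using h

lemma abs_smoothThreshold_sub_le (k ε a b : ℝ) :
    |smoothThreshold k ε a - smoothThreshold k ε b| ≤ 2 * |a - b| := by
  have h1 := abs_sqrt_sq_add_sub_le ε (a - k) (b - k)
  have h2 := abs_sqrt_sq_add_sub_le ε (a + k) (b + k)
  rw [sub_sub_sub_cancel_right] at h1
  rw [add_sub_add_right_eq_sub] at h2
  unfold smoothThreshold
  have h3 := neg_abs_le (a - b)
  have h4 := le_abs_self (a - b)
  rw [abs_le] at h1 h2 ⊢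
  constructor <;> linarith [h1.1, h1.2, h2.1, h2.2]

lemma contDiff_smoothThreshold (k : ℝ) {ε : ℝ} (hε : 0 < ε) :
    ContDiff ℝ ∞ (smoothThreshold k ε) := by
  unfold smoothThreshold
  refine contDiff_id.add (ContDiff.div_const (ContDiff.sub ?_ ?_) _)
  · exact ContDiff.sqrt (by fun_prop) fun t => by positivity
  · exact ContDiff.sqrt (by fun_prop) fun t => by positivity

lemma tendsto_smoothThreshold (k t : ℝ) :
    Tendsto (fun n : ℕ => smoothThreshold k (1 / ((n : ℝ) + 1)) t) atTop
      (𝓝 (softThreshold k t)) := by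
  have hc : Continuous (fun ε : ℝ => smoothThreshold k ε t) := by
    unfold smoothThreshold; fun_prop
  have h := (hc.tendsto 0).comp (tendsto_one_div_add_atTop_nhds_zero_nat (𝕜 := ℝ))
  have e : smoothThreshold k 0 t = softThreshold k t := by
    simp [smoothThreshold, softThreshold, Real.sqrt_sq_eq_abs]
  rwa [e] at h

lemma softThreshold_comp_mem_tildeW0 (hN : 0 < (N : ℝ)) (hp : 1 < p) (hs : 0 < s) (hs1 : s < 1)
    (hΩ : Bornology.IsBounded Ω) {k : ℝ} (hk : 0 ≤ k) (hu : u ∈ tildeW0 s p Ω) :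
    softThreshold k ∘ u ∈ tildeW0 s p Ω := by
  have hGt := gagliardo_ne_top_of_mem_tildeW0 hN hp hs hs1 hu
  have hmem : ∀ n : ℕ, smoothThreshold k (1 / ((n : ℝ) + 1)) ∘ u ∈ tildeW0 s p Ω := fun n =>
    comp_smooth_mem_tildeW0 hN hp hs hs1 hΩ (contDiff_smoothThreshold k (by positivity))
      (by simp [smoothThreshold]) zero_le_two (abs_smoothThreshold_sub_le _ _) hu
  have hm := (continuous_softThreshold k).comp_aestronglyMeasurable hu.1
  refine mem_tildeW0_of_tendsto hp hm ?_ hmem ?_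
  · filter_upwards [hu.2.1] with x hx hxΩ
    simp [hx hxΩ, softThreshold]
  -- The reference sequence is constantly u: the smooth truncations of u are uniformly 2-Lipschitz
  -- in u, so pointwise convergence suffices.
  · refine tendsto_gagliardo_sub (φ := fun _ => u) hp.le zero_le_two hu.1 hm
      (fun n => (hmem n).1) hGt ?_ (fun x y => ?_)
      (fun n x y => abs_smoothThreshold_sub_le _ _ _ _)
      (ae_of_all _ fun x => tendsto_smoothThreshold k (u x))
    · have hp0 : 0 < p := by linarith
      simp [gagliardo, hp0]
    · exact (abs_softThreshold_sub_le hk _ _).trans (by linarith [abs_nonneg (u x - u y)])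

end TildeSpace

/-! ### Stampacchia iteration -/

section Stampacchia

/-- Stampacchia's iteration lemma. -/
lemma stampacchia {b : ℝ → ℝ} (hb : ∀ k, 0 ≤ b k) (hanti : Antitone b) {β K b₀ d : ℝ}
    (hβ : 1 < β) (hK : 0 ≤ K) (hb0 : b 0 ≤ b₀)
    (hstep : ∀ k h, 0 ≤ k → k < h → (h - k) * b h ≤ K * b k ^ β) (hd : 0 < d)
    (hKd : K * b₀ ^ (β - 1) * 2 ^ (β / (β - 1)) ≤ d) : b d = 0 := by
  have hb₀ : 0 ≤ b₀ := (hb 0).trans hb0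
  have hβ1 : 0 < β - 1 := by linarith
  -- ρ is chosen so that ρ^β = ρ/2. Along the levels d(1 - 2^{-n}) the gap halves at each step, and
  -- this identity lets the decay b₀ρ^n reproduce itself.
  set ρ : ℝ := 2 ^ (-(1 / (β - 1))) with hρ
  have hρ0 : 0 < ρ := by positivity
  have hρ1 : ρ < 1 := Real.rpow_lt_one_of_one_lt_of_neg one_lt_two
    (neg_neg_of_pos (by positivity))
  set τ : ℝ := ρ ^ β with hτ
  have hτ0 : 0 < τ := by positivity
  have hτρ : 1 / 2 * ρ = τ := by
    rw [hτ, hρ, ← Real.rpow_mul zero_le_two, one_div, ← Real.rpow_neg_one,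
      ← Real.rpow_add two_pos]
    congr 1
    field_simp
    ring
  have hτinv : (2 : ℝ) ^ (β / (β - 1)) = τ⁻¹ := by
    rw [hτ, hρ, ← Real.rpow_mul zero_le_two, ← Real.rpow_neg zero_le_two]
    congr 1
    ring
  rw [hτinv] at hKd
  have hbβ : b₀ ^ β = b₀ ^ (β - 1) * b₀ := by
    rcases eq_or_lt_of_le hb₀ with h | h
    · rw [← h, Real.zero_rpow (by linarith), mul_zero]
    · rw [Real.rpow_sub h, Real.rpow_one, div_mul_cancel₀ _ h.ne']
  have key : ∀ n : ℕ, b (d * (1 - (1 / 2) ^ n)) ≤ b₀ * ρ ^ n := by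
    intro n
    induction n with
    | zero => simpa using hb0
    | succ n ih =>
      have hpos : (0 : ℝ) < (1 / 2) ^ (n + 1) := by positivity
      have h1 := hstep (d * (1 - (1 / 2) ^ n)) (d * (1 - (1 / 2) ^ (n + 1)))
        (mul_nonneg hd.le (sub_nonneg.2 (pow_le_one₀ (by norm_num) (by norm_num))))
        (by rw [pow_succ] at hpos ⊢; nlinarith)
      rw [show d * (1 - (1 / 2 : ℝ) ^ (n + 1)) - d * (1 - (1 / 2) ^ n) = d * (1 / 2) ^ (n + 1) by
        ring] at h1
      have h2 : b (d * (1 - (1 / 2) ^ n)) ^ β ≤ b₀ ^ β * τ ^ n := by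
        refine (Real.rpow_le_rpow (hb _) ih (by linarith)).trans (le_of_eq ?_)
        rw [Real.mul_rpow hb₀ (by positivity), hτ, ← Real.rpow_natCast, ← Real.rpow_mul hρ0.le,
          ← Real.rpow_natCast, ← Real.rpow_mul hρ0.le, mul_comm (n : ℝ)]
      refine le_of_mul_le_mul_left ?_ (mul_pos hd hpos)
      calc d * (1 / 2) ^ (n + 1) * b (d * (1 - (1 / 2) ^ (n + 1)))
          ≤ K * (b₀ ^ β * τ ^ n) := h1.trans (by gcongr)
        _ = K * b₀ ^ (β - 1) * τ⁻¹ * (b₀ * τ ^ (n + 1)) := by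
            rw [hbβ, pow_succ]; field_simp
        _ ≤ d * (b₀ * τ ^ (n + 1)) := by gcongr
        _ = d * (1 / 2) ^ (n + 1) * (b₀ * ρ ^ (n + 1)) := by
            rw [← hτρ, mul_pow]; ring
  have hlim : Tendsto (fun n : ℕ => b₀ * ρ ^ n) atTop (𝓝 0) := by
    simpa using (tendsto_pow_atTop_nhds_zero_of_lt_one hρ0.le hρ1).const_mul b₀
  refine le_antisymm (ge_of_tendsto' hlim fun n => (hanti ?_).trans (key n)) (hb d)
  have : (0 : ℝ) < (1 / 2) ^ n := by positivity
  nlinarith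

end Stampacchia

/-! ### Energy estimate and decay of superlevel sets -/

section Estimate

variable {N : ℕ} {s p : ℝ} {Ω : Set (EuclideanSpace ℝ (Fin N))}
  {F u : EuclideanSpace ℝ (Fin N) → ℝ}

/-- With U = |a - b| and W the truncated increment, monotonicity makes the middle term U^{p-1}W, and
W ≤ U does the rest. The lower bound yields the energy of the truncation; the upper one,
integrability of the weak form. -/
lemma rpow_abs_softThreshold_le (hp : 1 < p) {k : ℝ} (hk : 0 ≤ k) (a b : ℝ) :
    |softThreshold k a - softThreshold k b| ^ p ≤
        |a - b| ^ (p - 2) * (a - b) * (softThreshold k a - softThreshold k b) ∧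
      |a - b| ^ (p - 2) * (a - b) * (softThreshold k a - softThreshold k b) ≤ |a - b| ^ p := by
  have h1 := abs_softThreshold_sub_le hk a b
  rw [mul_assoc, mul_softThreshold_sub hk]
  set U := |a - b| with hU
  set W := |softThreshold k a - softThreshold k b| with hW
  have hW0 : 0 ≤ W := abs_nonneg _
  have hU0 : 0 ≤ U := abs_nonneg _
  rcases eq_or_lt_of_le hU0 with h | h
  · have : W = 0 := by linarith
    rw [this, ← h, Real.zero_rpow (by linarith)]; simp
  have e : U ^ (p - 2) * (U * W) = U ^ (p - 1) * W := by
    rw [show p - 1 = p - 2 + 1 by ring, Real.rpow_add_one h.ne']; ring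
  have epow : ∀ x : ℝ, 0 ≤ x → x ^ (p - 1) * x = x ^ p := fun x hx => by
    nth_rewrite 2 [← Real.rpow_one x]
    rw [← Real.rpow_add_of_nonneg hx (by linarith) zero_le_one, sub_add_cancel]
  rw [e]
  constructor
  · rw [← epow W hW0]
    gcongr
  · rw [← epow U hU0]
    gcongr

lemma enorm_rpow_div_enorm_rpow (hp : 1 < p) {a : ℝ} (v : EuclideanSpace ℝ (Fin N) → ℝ)
    (x y : EuclideanSpace ℝ (Fin N)) :
    ‖v x - v y‖ₑ ^ p / ‖x - y‖ₑ ^ a = ENNReal.ofReal (|v x - v y| ^ p / ‖x - y‖ ^ a) := by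
  have hp0 : 0 < p := by linarith
  rcases eq_or_ne x y with rfl | hxy
  · simp [hp0, hp0.ne']
  have hxy0 : 0 < ‖x - y‖ := by simpa [sub_eq_zero] using hxy
  rw [ENNReal.ofReal_div_of_pos (by positivity), ← ENNReal.ofReal_rpow_of_pos hxy0,
    ← ENNReal.ofReal_rpow_of_nonneg (abs_nonneg _) hp0.le, ofReal_norm,
    Real.enorm_eq_ofReal_abs]

/-- Testing the equation with the truncated solution. -/
lemma gagliardo_softThreshold_le (hN : 0 < (N : ℝ)) (hp : 1 < p) (hs : 0 < s) (hs1 : s < 1)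
    (hΩ : Bornology.IsBounded Ω) (hu : IsWeakSolution s p Ω F u) {k : ℝ} (hk : 0 ≤ k) :
    gagliardo s p (softThreshold k ∘ u) ≤
      ∫⁻ x in Ω, ‖F x‖ₑ * ‖softThreshold k (u x)‖ₑ := by
  have hwt := softThreshold_comp_mem_tildeW0 hN hp hs hs1 hΩ hk hu.1
  have hGt := gagliardo_ne_top_of_mem_tildeW0 hN hp hs hs1 hu.1
  have heq := hu.2 _ hwt
  have hum := hu.1.1
  set I : EuclideanSpace ℝ (Fin N) × EuclideanSpace ℝ (Fin N) → ℝ := fun z =>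
    |u z.1 - u z.2| ^ (p - 2) * (u z.1 - u z.2) / ‖z.1 - z.2‖ ^ ((N : ℝ) + s * p) *
        ((softThreshold k ∘ u) z.1 - (softThreshold k ∘ u) z.2) with hI
  have hI' : ∀ z, I z = |u z.1 - u z.2| ^ (p - 2) * (u z.1 - u z.2) *
      (softThreshold k (u z.1) - softThreshold k (u z.2)) / ‖z.1 - z.2‖ ^ ((N : ℝ) + s * p) :=
    fun z => by simp only [hI, Function.comp_apply]; ring
  have hI0 : ∀ z, |softThreshold k (u z.1) - softThreshold k (u z.2)| ^ p /
      ‖z.1 - z.2‖ ^ ((N : ℝ) + s * p) ≤ I z := fun z => by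
    rw [hI']
    gcongr
    exact (rpow_abs_softThreshold_le hp hk _ _).1
  have hI1 : ∀ z, I z ≤ |u z.1 - u z.2| ^ p / ‖z.1 - z.2‖ ^ ((N : ℝ) + s * p) := fun z => by
    rw [hI']
    gcongr
    exact (rpow_abs_softThreshold_le hp hk _ _).2
  have hInn : ∀ z, 0 ≤ I z := fun z => le_trans (by positivity) (hI0 z)
  have hIm : AEStronglyMeasurable I volume := by
    have h1 := (aestronglyMeasurable_diff hum).aemeasurable
    have h2 := (aestronglyMeasurable_diff hwt.1).aemeasurable
    have h3 : Measurable (fun z : EuclideanSpace ℝ (Fin N) × EuclideanSpace ℝ (Fin N) =>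
      ‖z.1 - z.2‖ ^ ((N : ℝ) + s * p)) := by fun_prop
    refine AEMeasurable.aestronglyMeasurable ?_
    exact ((((continuous_abs.measurable.comp_aemeasurable h1).pow_const _).mul h1).div
      h3.aemeasurable).mul h2
  have hIint : Integrable I volume := by
    refine ⟨hIm, lt_of_le_of_lt (lintegral_mono fun z => ?_) hGt.lt_top⟩
    rw [enorm_rpow_div_enorm_rpow hp, Real.enorm_of_nonneg (hInn z)]
    exact ENNReal.ofReal_le_ofReal (hI1 z)
  calc gagliardo s p (softThreshold k ∘ u) ≤ ∫⁻ z, ENNReal.ofReal (I z) := by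
        refine lintegral_mono fun z => ?_
        rw [enorm_rpow_div_enorm_rpow hp]
        exact ENNReal.ofReal_le_ofReal (hI0 z)
    _ = ENNReal.ofReal (∫ z, I z) :=
        (ofReal_integral_eq_lintegral_ofReal hIint (ae_of_all _ hInn)).symm
    _ = ENNReal.ofReal (∫ x in Ω, F x * (softThreshold k ∘ u) x) := by rw [heq]
    _ ≤ ‖∫ x in Ω, F x * (softThreshold k ∘ u) x‖ₑ := by
        rw [Real.enorm_eq_ofReal_abs]; exact ENNReal.ofReal_le_ofReal (le_abs_self _)
    _ ≤ ∫⁻ x in Ω, ‖F x * (softThreshold k ∘ u) x‖ₑ := enorm_integral_le_lintegral_enorm _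
    _ = _ := by simp only [enorm_mul, Function.comp_apply]

lemma inv_toReal_lt {q : ℝ≥0∞} (hN : 0 < (N : ℝ)) (hp : 1 < p) (hs : 0 < s)
    (hq : ENNReal.ofReal (N / (s * p)) < q) : 1 / q.toReal < s * p / N := by
  have hp0 : 0 < p := by linarith
  -- For q = ∞ the conventions `⊤.toReal = 0` and `1 / 0 = 0` give the intended 1/q = 0.
  rcases eq_or_ne q ⊤ with rfl | hqt
  · simp; positivity
  · rw [ENNReal.ofReal_lt_iff_lt_toReal (by positivity) hqt] at hq
    rw [one_div_lt (lt_trans (by positivity) hq) (by positivity), one_div_div]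
    exact hq

lemma holderTriple_conjExp {q : ℝ≥0∞} (hq0 : q ≠ 0) (hq1 : 1 / q.toReal < 1) :
    ENNReal.HolderTriple q (ENNReal.ofReal (conjExp q)) 1 := by
  refine ⟨?_⟩
  have h0 : 0 < 1 - 1 / q.toReal := by linarith
  have h1 : q⁻¹ = ENNReal.ofReal (1 / q.toReal) := by
    rcases eq_or_ne q ⊤ with rfl | hqt
    · simp
    · rw [one_div, ENNReal.ofReal_inv_of_pos (ENNReal.toReal_pos hq0 hqt),
        ENNReal.ofReal_toReal hqt]
  rw [h1, conjExp, ENNReal.ofReal_inv_of_pos h0, inv_inv,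
    ← ENNReal.ofReal_add (by positivity) h0.le]
  simp

/-- Hölder with three factors f, w and the indicator of A; the last takes the leftover exponent 1 -
1/q - 1/b, which drives the decay. -/
lemma lintegral_mul_le_of_support {α : Type*} [MeasurableSpace α] {μ : Measure α} {f w : α → ℝ}
    (hf : AEStronglyMeasurable f μ) (hw : AEStronglyMeasurable w μ) {A : Set α}
    (hA : NullMeasurableSet A μ) (hwA : ∀ x, x ∉ A → w x = 0) {q : ℝ≥0∞} (hq0 : q ≠ 0)
    (hq1 : 1 / q.toReal < 1) {b : ℝ} (hb : conjExp q ≤ b) :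
    ∫⁻ x, ‖f x‖ₑ * ‖w x‖ₑ ∂μ ≤
      eLpNorm f q μ * ((∫⁻ x, ‖w x‖ₑ ^ b ∂μ) ^ (1 / b) * μ A ^ (1 - 1 / q.toReal - 1 / b)) := by
  have hr : 0 < conjExp q := inv_pos.2 (by linarith)
  have hb0 : 0 < b := hr.trans_le hb
  have hrinv : 1 / conjExp q = 1 - 1 / q.toReal := by rw [conjExp, one_div, inv_inv]
  have := holderTriple_conjExp hq0 hq1
  have hind : (fun x => ‖f x‖ₑ * ‖w x‖ₑ) = A.indicator (fun x => ‖f x‖ₑ * ‖w x‖ₑ) := by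
    ext x
    by_cases hx : x ∈ A
    · simp [hx]
    · simp [hx, hwA x hx]
  have hle : μ.restrict A ≤ μ := Measure.restrict_le_self
  rw [hind, lintegral_indicator₀ hA]
  calc ∫⁻ x in A, ‖f x‖ₑ * ‖w x‖ₑ ∂μ = eLpNorm (f • w) 1 (μ.restrict A) := by
        rw [eLpNorm_one_eq_lintegral_enorm]
        simp [enorm_mul]
    _ ≤ eLpNorm f q (μ.restrict A) * eLpNorm w (ENNReal.ofReal (conjExp q)) (μ.restrict A) :=
        eLpNorm_smul_le_mul_eLpNorm (hw.mono_measure hle) (hf.mono_measure hle)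
    _ ≤ _ := by
        gcongr ?_ * ?_
        · exact eLpNorm_mono_measure f hle
        rw [eLpNorm_ofReal_eq hr]
        refine (ENNReal.rpow_le_rpow (lintegral_rpow_le_rpow_mul_measure (hw.mono_measure hle)
          hr hb) (by positivity)).trans ?_
        rw [ENNReal.mul_rpow_of_nonneg _ _ (by positivity), ← ENNReal.rpow_mul,
          ← ENNReal.rpow_mul, Measure.restrict_apply_univ, ← hrinv,
          show conjExp q / b * (1 / conjExp q) = 1 / b by field_simp,
          show (1 - conjExp q / b) * (1 / conjExp q) = 1 / conjExp q - 1 / b by field_simp]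
        gcongr

lemma nullMeasurableSet_superlevel {μ : Measure (EuclideanSpace ℝ (Fin N))}
    (hu : AEStronglyMeasurable u μ) (k : ℝ) : NullMeasurableSet {x | k < |u x|} μ :=
  nullMeasurableSet_lt aemeasurable_const (continuous_abs.measurable.comp_aemeasurable
    hu.aemeasurable)

/-- Decay of the superlevel sets of a weak solution. -/
lemma superlevel_decay (hN : 0 < (N : ℝ)) (hp : 1 < p) (hs : 0 < s) (hs1 : s < 1)
    (hsp : s * p < N) (hΩ : Bornology.IsBounded Ω) {q : ℝ≥0∞}
    (hq : ENNReal.ofReal (N / (s * p)) < q) (hF : MemLp F q (volume.restrict Ω))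
    (hu : IsWeakSolution s p Ω F u) {k h : ℝ} (hk : 0 ≤ k)
    (hb : conjExp q ≤ pStar N s p) :
    ENNReal.ofReal (h - k) * (volume.restrict Ω {x | h < |u x|}) ^ (1 / pStar N s p) ≤
      (sobolevConst N s p * eLpNorm F q (volume.restrict Ω)) ^ (1 / (p - 1)) *
        ((volume.restrict Ω {x | k < |u x|}) ^
          (1 - 1 / q.toReal - 1 / pStar N s p)) ^ (1 / (p - 1)) := by
  have hp0 : 0 < p := by linarith
  have hp1 : 0 < p - 1 := by linarith
  have hps := pStar_pos hN hp0 hsp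
  have hwt := softThreshold_comp_mem_tildeW0 hN hp hs hs1 hΩ hk hu.1
  have hwG := gagliardo_ne_top_of_mem_tildeW0 hN hp hs hs1 hwt
  have hθ1 : s * p / N < 1 := (div_lt_one hN).2 hsp
  have hq1 := inv_toReal_lt hN hp hs hq
  have hq0 : q ≠ 0 := (zero_le.trans_lt hq).ne'
  set w := softThreshold k ∘ u with hw
  set X := ∫⁻ y, ‖w y‖ₑ ^ pStar N s p with hX
  set Y := X ^ (1 / pStar N s p) with hY
  have hYp : X ^ (p / pStar N s p) = Y ^ p := by
    rw [hY, ← ENNReal.rpow_mul]; congr 1; ring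
  have hsob := sobolev_tildeW0 hN hp hs hs1 hsp hΩ hwt
  -- Finiteness of the L^{p*} norm Y permits dividing Y^p ≤ T f m Y by Y.
  have hYt : Y ≠ ⊤ := by
    intro hYtop
    rw [← hX, hYp, hYtop, ENNReal.top_rpow_of_pos hp0, top_le_iff] at hsob
    exact ENNReal.mul_ne_top (sobolevConst_lt_top hN hp hs hsp).ne hwG hsob
  have hwzero : ∀ x, x ∉ {x | k < |u x|} → w x = 0 := fun x hx => by
    rw [← abs_eq_zero, hw, Function.comp_apply, abs_softThreshold hk,
      max_eq_right (by simpa using hx)]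
  have hrhs : ∫⁻ x in Ω, ‖F x‖ₑ * ‖w x‖ₑ ≤ eLpNorm F q (volume.restrict Ω) *
      (Y * (volume.restrict Ω {x | k < |u x|}) ^ (1 - 1 / q.toReal - 1 / pStar N s p)) := by
    refine (lintegral_mul_le_of_support hF.1 hwt.1.restrict
      (nullMeasurableSet_superlevel hu.1.1.restrict k) hwzero hq0 (by linarith) hb).trans ?_
    gcongr
    exact ENNReal.rpow_le_rpow (setLIntegral_le_lintegral _ _) (by positivity)
  set T := sobolevConst N s p with hT
  set f := eLpNorm F q (volume.restrict Ω) with hf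
  set m := (volume.restrict Ω {x | k < |u x|}) ^ (1 - 1 / q.toReal - 1 / pStar N s p) with hm
  have hYle : Y ≤ (T * f * m) ^ (1 / (p - 1)) := by
    have h1 : Y ^ p ≤ T * f * m * Y := by
      rw [← hYp]
      refine (hsob.trans (mul_le_mul_right ((gagliardo_softThreshold_le hN hp hs hs1 hΩ hu
        hk).trans hrhs) _)).trans (le_of_eq ?_)
      ring
    rcases eq_or_ne Y 0 with hY0 | hY0
    · rw [hY0]; exact zero_le
    have h2 : Y ^ (p - 1) ≤ T * f * m := by
      rw [ENNReal.rpow_sub _ _ hY0 hYt, ENNReal.rpow_one]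
      exact ENNReal.div_le_of_le_mul h1
    have h3 := ENNReal.rpow_le_rpow h2 (by positivity : 0 ≤ 1 / (p - 1))
    rwa [← ENNReal.rpow_mul, mul_one_div_cancel hp1.ne', ENNReal.rpow_one] at h3
  rw [← ENNReal.mul_rpow_of_nonneg _ _ (by positivity)]
  refine le_trans ?_ hYle
  -- Chebyshev, since |w| ≥ h - k where |u| > h.
  have hcheb : ENNReal.ofReal (h - k) ^ pStar N s p * volume.restrict Ω {x | h < |u x|} ≤ X := by
    calc ENNReal.ofReal (h - k) ^ pStar N s p * volume.restrict Ω {x | h < |u x|}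
        ≤ ENNReal.ofReal (h - k) ^ pStar N s p *
          volume {x | ENNReal.ofReal (h - k) ^ pStar N s p ≤ ‖w x‖ₑ ^ pStar N s p} := by
          refine mul_le_mul_right
            ((Measure.restrict_le_self _).trans (measure_mono fun x hx => ?_)) _
          simp only [Set.mem_ofPred_eq] at hx ⊢
          gcongr
          rw [Real.enorm_eq_ofReal_abs, hw, Function.comp_apply, abs_softThreshold hk]
          exact ENNReal.ofReal_le_ofReal (le_max_of_le_left (by linarith))
      _ ≤ X := mul_meas_ge_le_lintegral₀ (hwt.1.enorm.pow_const _) _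
  have h5 := ENNReal.rpow_le_rpow hcheb (by positivity : 0 ≤ 1 / pStar N s p)
  rwa [ENNReal.mul_rpow_of_nonneg _ _ (by positivity), ← ENNReal.rpow_mul,
    mul_one_div_cancel hps.ne', ENNReal.rpow_one] at h5

end Estimate

/-! ### Exponents and constants; the a priori bound -/

section Main

variable {N : ℕ} {s p : ℝ} {q : ℝ≥0∞}

lemma chi_eq (hp : 1 < p) (hq1 : 1 / q.toReal < 1) :
    chi N s p q = pStar N s p * (1 - 1 / q.toReal) / p := by
  have : 1 - 1 / q.toReal ≠ 0 := by linarith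
  rw [chi, conjExp]
  field_simp

lemma one_lt_chi (hN : 0 < (N : ℝ)) (hp : 1 < p) (hsp : s * p < N)
    (hq : 1 / q.toReal < s * p / N) : 1 < chi N s p q := by
  have hp0 : 0 < p := by linarith
  have hθ1 : s * p / N < 1 := (div_lt_one hN).2 hsp
  have hps := pStar_pos hN hp0 hsp
  have hdiv := div_pStar hN hp0 hsp
  rw [chi_eq hp (by linarith), one_lt_div hp0]
  calc p = pStar N s p * (1 - s * p / N) := by rw [← hdiv]; field_simp
    _ < _ := by gcongr

lemma conjExp_le_pStar (hN : 0 < (N : ℝ)) (hp : 1 < p) (hsp : s * p < N)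
    (hq : 1 / q.toReal < s * p / N) : conjExp q ≤ pStar N s p := by
  have hp0 : 0 < p := by linarith
  have hθ1 : s * p / N < 1 := (div_lt_one hN).2 hsp
  have hps := pStar_pos hN hp0 hsp
  have h0 : 0 < 1 - 1 / q.toReal := by linarith
  have h1 := one_lt_chi hN hp hsp hq
  rw [chi_eq hp (by linarith), one_lt_div hp0] at h1
  rw [conjExp, inv_le_iff_one_le_mul₀ h0]
  linarith

/-- The left side is Stampacchia's factor 2^{β/(β-1)}. It has the stated form because pχ - 1 ≤ pχ
and χ^{1/(χ-1)} ≥ 1. -/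
lemma two_rpow_le_chi_bound {χ : ℝ} (hp : 1 < p) (hχ : 1 < χ) :
    (2 : ℝ) ^ ((p * χ - 1) / (p * (χ - 1))) ≤ (2 * χ ^ (1 / (χ - 1))) ^ (χ / (χ - 1)) := by
  have hχ0 : 0 < χ - 1 := by linarith
  have h1 : (1 : ℝ) ≤ χ ^ (1 / (χ - 1)) := Real.one_le_rpow hχ.le (by positivity)
  calc (2 : ℝ) ^ ((p * χ - 1) / (p * (χ - 1))) ≤ 2 ^ (χ / (χ - 1)) := by
        refine Real.rpow_le_rpow_of_exponent_le one_le_two ?_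
        rw [div_le_div_iff₀ (by positivity) hχ0]
        nlinarith
    _ ≤ _ := by
        gcongr
        linarith

/-- The superlevel set at the height given by the a priori bound is null. -/
lemma superlevel_null (hN : 0 < (N : ℝ)) (hp : 1 < p) (hs : 0 < s) (hs1 : s < 1)
    (hsp : s * p < N) {Ω : Set (EuclideanSpace ℝ (Fin N))} (hΩ : Bornology.IsBounded Ω)
    (hq : ENNReal.ofReal (N / (s * p)) < q) {F u : EuclideanSpace ℝ (Fin N) → ℝ}
    (hF : MemLp F q (volume.restrict Ω)) (hu : IsWeakSolution s p Ω F u) {d : ℝ} (hd : 0 < d)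
    (hdle : (2 * chi N s p q ^ (1 / (chi N s p q - 1))) ^ (chi N s p q / (chi N s p q - 1)) *
      ((sobolevConst N s p).toReal * (volume Ω).toReal ^ (s * p / N - 1 / q.toReal) *
        (eLpNorm F q (volume.restrict Ω)).toReal) ^ (1 / (p - 1)) ≤ d) :
    volume.restrict Ω {x | d < |u x|} = 0 := by
  have hp0 : 0 < p := by linarith
  have hp1 : 0 < p - 1 := by linarith
  have hps := pStar_pos hN hp0 hsp
  have hκ := inv_toReal_lt hN hp hs hq
  have hθ1 : s * p / N < 1 := (div_lt_one hN).2 hsp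
  have hχ := one_lt_chi hN hp hsp hκ
  have hχe := chi_eq (N := N) (s := s) hp (hκ.trans hθ1)
  have hdiv := div_pStar hN hp0 hsp
  have hΩt : volume Ω ≠ ⊤ := hΩ.measure_lt_top.ne
  have hmt : ∀ k, volume.restrict Ω {x | k < |u x|} ≠ ⊤ := fun k =>
    ne_top_of_le_ne_top hΩt ((measure_mono (Set.subset_univ _)).trans (by simp))
  set χ := chi N s p q with hχdef
  set P := pStar N s p with hP
  set κ := 1 / q.toReal with hκdef
  set T := (sobolevConst N s p).toReal with hT
  set f := (eLpNorm F q (volume.restrict Ω)).toReal with hf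
  set V := (volume Ω).toReal with hV
  set a : ℝ → ℝ := fun k => (volume.restrict Ω {x | k < |u x|}).toReal with ha
  set b : ℝ → ℝ := fun k => a k ^ (1 / P) with hb
  have ha0 : ∀ k, 0 ≤ a k := fun k => ENNReal.toReal_nonneg
  have hT0 : 0 ≤ T := ENNReal.toReal_nonneg
  have hf0 : 0 ≤ f := ENNReal.toReal_nonneg
  have hV0 : 0 ≤ V := ENNReal.toReal_nonneg
  set β : ℝ := (p * χ - 1) / (p - 1) with hβ
  have hβ1 : β - 1 = p * (χ - 1) / (p - 1) := by rw [hβ]; field_simp; ring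
  have hβgt : 1 < β := by
    have : 0 < β - 1 := by
      rw [hβ1]
      have : 0 < χ - 1 := by linarith
      positivity
    linarith
  have hpχ : p * χ = P * (1 - κ) := by rw [hχe]; field_simp
  have hβP : 1 / P * β = (1 - κ - 1 / P) * (1 / (p - 1)) := by
    rw [hβ, hpχ]; field_simp
  -- The identity p/p* = 1 - sp/N produces the power sp/N - 1/q of |Ω| from b₀^{β-1}, where b₀ =
  -- |Ω|^{1/p*}.
  have hβP1 : 1 / P * (β - 1) = (s * p / N - κ) * (1 / (p - 1)) := by
    have e : p / P = 1 - s * p / N := hdiv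
    have e2 : 1 / P * (β - 1) = (1 - κ - p / P) * (1 / (p - 1)) := by
      rw [hβ1, mul_sub, hpχ]; field_simp
    rw [e2, e]; ring
  have hanti : Antitone b := fun k h hkh => by
    simp only [hb, ha]
    refine Real.rpow_le_rpow (ha0 h) (ENNReal.toReal_mono (hmt k) (measure_mono fun x hx => ?_))
      (by positivity)
    exact lt_of_le_of_lt hkh hx
  have hb0 : b 0 ≤ V ^ (1 / P) := by
    refine Real.rpow_le_rpow (ha0 0) (ENNReal.toReal_mono hΩt
      ((measure_mono (Set.subset_univ _)).trans (by simp))) (by positivity)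
  have hstep : ∀ k h, 0 ≤ k → k < h → (h - k) * b h ≤ (T * f) ^ (1 / (p - 1)) * b k ^ β := by
    intro k h hk hkh
    have h1 := superlevel_decay (h := h) hN hp hs hs1 hsp hΩ hq hF hu hk
      (conjExp_le_pStar hN hp hsp hκ)
    have hγ : 0 ≤ 1 - 1 / q.toReal - 1 / pStar N s p := by
      have : 0 < 1 / P * β := by
        have : 0 < β := by linarith
        positivity
      rw [hβP] at this
      exact (pos_of_mul_pos_left this (by positivity)).le
    have h2 := ENNReal.toReal_mono (ENNReal.mul_ne_top
      (ENNReal.rpow_ne_top_of_nonneg (by positivity)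
        (ENNReal.mul_ne_top (sobolevConst_lt_top hN hp hs hsp).ne hF.2.ne))
      (ENNReal.rpow_ne_top_of_nonneg (by positivity)
        (ENNReal.rpow_ne_top_of_nonneg hγ (hmt k)))) h1
    rw [ENNReal.toReal_mul, ENNReal.toReal_mul, ENNReal.toReal_ofReal (by linarith),
      ← ENNReal.toReal_rpow, ← ENNReal.toReal_rpow, ← ENNReal.toReal_rpow,
      ← ENNReal.toReal_rpow, ENNReal.toReal_mul] at h2
    refine h2.trans (le_of_eq ?_)
    congr 1
    simp only [hb]
    rw [← Real.rpow_mul (ha0 k) (1 / P), hβP, Real.rpow_mul (ha0 k)]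
  have hzero : b d = 0 := by
    refine stampacchia (fun k => Real.rpow_nonneg (ha0 k) _) hanti hβgt
      (Real.rpow_nonneg (mul_nonneg hT0 hf0) _) hb0 hstep hd (le_trans ?_ hdle)
    have hexp : β / (β - 1) = (p * χ - 1) / (p * (χ - 1)) := by
      have : χ - 1 ≠ 0 := by linarith
      rw [hβ1, hβ]; field_simp
    have hK : (T * f) ^ (1 / (p - 1)) * (V ^ (1 / P)) ^ (β - 1) =
        (T * V ^ (s * p / N - κ) * f) ^ (1 / (p - 1)) := by
      rw [← Real.rpow_mul hV0, hβP1, Real.rpow_mul hV0,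
        ← Real.mul_rpow (mul_nonneg hT0 hf0) (Real.rpow_nonneg hV0 _)]
      congr 1; ring
    rw [hK, hexp, mul_comm]
    exact mul_le_mul_of_nonneg_right (two_rpow_le_chi_bound hp hχ)
      (Real.rpow_nonneg (mul_nonneg (mul_nonneg hT0 (Real.rpow_nonneg hV0 _)) hf0) _)
  have h3 : a d = 0 := by
    by_contra hne
    exact (Real.rpow_pos_of_pos (lt_of_le_of_ne (ha0 d) (Ne.symm hne)) _).ne' hzero
  exact ((ENNReal.toReal_eq_zero_iff _).1 h3).resolve_right (hmt d)

end Main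

end FracPLap

theorem mainTheorem6 (p : ℝ) (hp : 1 < p) :
    ∃ C : ℝ, 0 < C ∧
      ∀ (N : ℕ) (s : ℝ), 0 < s → s < 1 → s * p < N →
      ∀ Ω : Set (EuclideanSpace ℝ (Fin N)), IsOpen Ω → Bornology.IsBounded Ω →
      ∀ q : ℝ≥0∞, ENNReal.ofReal (N / (s * p)) < q →
      ∀ F : EuclideanSpace ℝ (Fin N) → ℝ, MemLp F q (volume.restrict Ω) →
      ∀ u : EuclideanSpace ℝ (Fin N) → ℝ, FracPLap.IsWeakSolution s p Ω F u →
        MemLp u ⊤ (volume.restrict Ω) ∧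
        FracPLap.sobolevConst N s p < ⊤ ∧
        eLpNorm u ⊤ (volume.restrict Ω) ≤
          ENNReal.ofReal
            ((C * FracPLap.chi N s p q ^ (1 / (FracPLap.chi N s p q - 1))) ^
              (FracPLap.chi N s p q / (FracPLap.chi N s p q - 1))) *
          (FracPLap.sobolevConst N s p * volume Ω ^ (s * p / N - 1 / q.toReal) *
            eLpNorm F q (volume.restrict Ω)) ^ (1 / (p - 1)) := by
  -- The iteration gives a constant independent even of p.
  refine ⟨2, two_pos, fun N s hs hs1 hsp Ω _ hΩ q hq F hF u hu => ?_⟩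
  have hp0 : 0 < p := by linarith
  have hp1 : 0 < p - 1 := by linarith
  have hN : 0 < (N : ℝ) := lt_trans (by positivity) hsp
  have hT := FracPLap.sobolevConst_lt_top hN hp hs hsp
  have hκ := FracPLap.inv_toReal_lt hN hp hs hq
  have hχ := FracPLap.one_lt_chi hN hp hsp hκ
  set A : ℝ := (2 * FracPLap.chi N s p q ^ (1 / (FracPLap.chi N s p q - 1))) ^
    (FracPLap.chi N s p q / (FracPLap.chi N s p q - 1)) with hA
  have hA0 : 0 ≤ A := by positivity
  set R : ℝ≥0∞ := ENNReal.ofReal A *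
    (FracPLap.sobolevConst N s p * volume Ω ^ (s * p / N - 1 / q.toReal) *
      eLpNorm F q (volume.restrict Ω)) ^ (1 / (p - 1)) with hR
  have hRt : R ≠ ⊤ := by
    refine ENNReal.mul_ne_top ENNReal.ofReal_ne_top (ENNReal.rpow_ne_top_of_nonneg (by positivity)
      (ENNReal.mul_ne_top (ENNReal.mul_ne_top hT.ne ?_) hF.2.ne))
    exact ENNReal.rpow_ne_top_of_nonneg (by linarith) hΩ.measure_lt_top.ne
  have hRreal : R.toReal = A * ((FracPLap.sobolevConst N s p).toReal *
      (volume Ω).toReal ^ (s * p / N - 1 / q.toReal) *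
      (eLpNorm F q (volume.restrict Ω)).toReal) ^ (1 / (p - 1)) := by
    rw [hR, ENNReal.toReal_mul, ENNReal.toReal_ofReal hA0, ← ENNReal.toReal_rpow,
      ENNReal.toReal_mul, ENNReal.toReal_mul, ← ENNReal.toReal_rpow]
  -- Heights strictly above R are used because the iteration needs d > 0 while R may be 0; then d ↓
  -- R.
  have hbound : ∀ d : ℝ, R.toReal < d →
      eLpNorm u ⊤ (volume.restrict Ω) ≤ ENNReal.ofReal d := fun d hd => by
    have hd0 : 0 < d := ENNReal.toReal_nonneg.trans_lt hd
    have hnull := FracPLap.superlevel_null hN hp hs hs1 hsp hΩ hq hF hu hd0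
      (hRreal ▸ hd.le)
    rw [eLpNorm_exponent_top]
    refine eLpNormEssSup_le_of_ae_bound ?_
    rw [ae_iff]
    simpa [not_le] using hnull
  have hle : eLpNorm u ⊤ (volume.restrict Ω) ≤ R := by
    rw [← ENNReal.ofReal_toReal hRt]
    have hlim : Tendsto (fun d : ℝ => ENNReal.ofReal d) (𝓝[>] R.toReal)
        (𝓝 (ENNReal.ofReal R.toReal)) :=
      ENNReal.tendsto_ofReal (tendsto_nhdsWithin_of_tendsto_nhds tendsto_id)
    refine ge_of_tendsto hlim ?_
    filter_upwards [self_mem_nhdsWithin] with d hd using hbound d hd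
  exact ⟨⟨hu.1.1.restrict, hle.trans_lt hRt.lt_top⟩, hT, hle⟩
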